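/- Let $H$ be a (not necessarily commutative) monoid. For $a\in H$, the set of lengths $\mathsf L(a)$ is $\{0\}$ if $a$ is a unit, and otherwise it is the set of all $k\in\mathbb N=\{1,2,\dots\}$ such that $a$ is a product of $k$ atoms (an atom is a non-unit $u$ such that $u=bc$ implies that $b$ or $c$ is a unit). The monoid $H$ is half-factorial if $|\mathsf L(a)|=1$ for all $a\in H$. Let $\llbracket a\rrbracket$ be the smallest submonoid of $H$ that contains $a$ and is divisor-closed, i.e. contains $b$ whenever it contains $xby$ (for $x,b,y\in H$). The half-factoriality index $\mathsf{hf}(H)\in\mathbb N\cup\{\infty\}$ is the infimum (with $\inf\emptyset=\infty$) of all $N\in\mathbb N$ with the property that, for every $a\in H$, if $|\mathsf L(a^N)|=1$, then $\llbracket a\rrbracket$ is half-factorial. Let $G$ be an additive abelian group. Let $\exp(G)\in\mathbb N\cup\{\infty\}$ be the least common multiple of the orders of its elements, with $\exp(G)=\infty$ if these have no common multiple in $\mathbb N$. Let $\mathcal B(G)$ be the monoid of zero-sum sequences over $G$: finite unordered sequences (multisets) of elements of $G$ with sum $0$, under concatenation. $H$ is a transfer Krull monoid over $G$ if there is a weak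 transfer homomorphism $\theta\colon H\to\mathcal B(G)$, i.e. a surjective monoid homomorphism such that $\theta(a)$ is the empty sequence if and only if $a$ is a unit, and such that, whenever $a\in H$ and $\theta(a)=v_1\cdots v_n$ with $n\ge 1$ and atoms $v_i$ of $\mathcal B(G)$, there are atoms $u_1,\dots,u_n$ of $H$ and a permutation $\tau$ of $\{1,\dots,n\}$ with $a=u_1\cdots u_n$ and $\theta(u_i)=v_{\tau(i)}$ for all $i$. **Theorem.** Let $H$ be a transfer Krull monoid over an abelian group $G$. 1. $\mathsf{hf}(H)<\infty$ if and only if $\exp(G)<\infty$. 2. If $\exp(G)<\infty$ and $|G|\ge 3$, then $\exp(G)\le\mathsf{hf}(H)$; if moreover $\exp(G)\ge 3$, then also $\mathsf{hf}(H)\le\frac32(\exp(G)-1)$. 3. If $|G|\ne 2$, and $G$ is cyclic (finite or infinite) or $\exp(G)\le 6$, then $\mathsf{hf}(H)=\exp(G)$. -/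

import Mathlib

/-- The set of lengths `L(a)` of an element `a` of a monoid: `{0}` if `a` is a unit, and otherwise
the set of all `k` such that `a` is a product of `k` atoms. -/
def lengthSet {H : Type*} [Monoid H] (a : H) : Set ℕ :=
  {k | (IsUnit a ∧ k = 0) ∨
    (¬ IsUnit a ∧ ∃ l : List H, (∀ u ∈ l, Irreducible u) ∧ l.prod = a ∧ l.length = k)}

/-- A monoid is half-factorial if every element has exactly one factorization length. -/
def IsHalfFactorial (H : Type*) [Monoid H] : Prop :=
  ∀ a : H, (lengthSet a).encard = 1

/-- A submonoid is divisor-closed if it contains every divisor of each of its elements,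
where `b` divides `c` if `c = x * b * y` for some `x` and `y`. -/
def IsDivisorClosed {H : Type*} [Monoid H] (S : Submonoid H) : Prop :=
  ∀ x b y : H, x * b * y ∈ S → b ∈ S

/-- The smallest divisor-closed submonoid `⟦a⟧` containing `a`. If the monoid is commutative, then
it consists of the divisors of the powers of `a`. -/
def divisorClosure {H : Type*} [Monoid H] (a : H) : Submonoid H :=
  sInf {S : Submonoid H | IsDivisorClosed S ∧ a ∈ S}

/-- The half-factoriality index `hf(H)`: the infimum in `ℕ ∪ {∞}` of all positive integers `N` such
that, for all `a`, if `|L(a ^ N)| = 1` then `⟦a⟧` is half-factorial. The infimum of the empty set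
is `∞`. -/
noncomputable def hfIndex (H : Type*) [Monoid H] : ℕ∞ :=
  sInf {M : ℕ∞ | ∃ N : ℕ, 0 < N ∧ M = N ∧
    ∀ a : H, (lengthSet (a ^ N)).encard = 1 → IsHalfFactorial (divisorClosure a)}

/-- Finite unordered sequences over `G` with sum zero, written additively. -/
def zeroSumSubmonoid (G : Type*) [AddCommGroup G] : AddSubmonoid (Multiset G) where
  carrier := {S | S.sum = 0}
  zero_mem' := Multiset.sum_zero
  add_mem' := by
    intro S T hS hT
    simp only [Set.mem_setOf_eq] at hS hT ⊢
    rw [Multiset.sum_add, hS, hT, add_zero]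

/-- The (multiplicatively written) monoid `𝓑(G)` of zero-sum sequences over `G`. -/
abbrev ZeroSumMonoid (G : Type*) [AddCommGroup G] : Type _ :=
  Multiplicative (zeroSumSubmonoid G)

/-- Weak transfer homomorphisms of monoids. -/
structure IsWeakTransferHom {H T : Type*} [Monoid H] [Monoid T] (θ : H →* T) : Prop where
  /-- Up to units on both sides, `θ` is surjective. -/
  surj : ∀ t : T, ∃ (a : H) (ε η : Tˣ), t = ε * θ a * η
  /-- The preimage of the group of units is the group of units. -/
  isUnit_iff : ∀ a : H, IsUnit (θ a) ↔ IsUnit a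
  /-- Every factorization of `θ a` into `n ≥ 1` atoms lifts, up to order and units, to a
  factorization of `a` into `n` atoms. -/
  lift : ∀ (a : H) (l : List T), l ≠ [] → (∀ v ∈ l, Irreducible v) → θ a = l.prod →
    ∃ (m : List H) (l' : List T), (∀ u ∈ m, Irreducible u) ∧ a = m.prod ∧ l'.Perm l ∧
      List.Forall₂ (fun u v => ∃ ε η : Tˣ, θ u = ε * v * η) m l'

/-- `H` is a transfer Krull monoid over the abelian group `G`. -/
def IsTransferKrullOver (H G : Type*) [Monoid H] [AddCommGroup G] : Prop :=
  ∃ θ : H →* ZeroSumMonoid G, IsWeakTransferHom θ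

open Classical in
/-- The exponent of a group as an element of `ℕ ∪ {∞}`: the least common multiple of the orders of
its elements if there is a positive common multiple, and `∞` otherwise. -/
noncomputable def groupExp (G : Type*) [AddCommGroup G] : ℕ∞ :=
  if AddMonoid.ExponentExists G then (AddMonoid.exponent G : ℕ∞) else ⊤

namespace ZeroSum

/-! The units of `𝓑(G)` are trivial and factorizations lift along the weak transfer homomorphism
`θ`, so `a` and `θ a` have the same lengths, and `⟦a⟧` is half-factorial exactly when all zero-sum
sequences over the support of `θ a` have a unique length. The index therefore depends on `G` only,
through `PowerDetectsUniqueLength` (`forall_isHalfFactorial_iff`).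

Lower bound. For `g` of order at least 3 and `N` below that order, the only atom dividing
`(g(-g))^N` is `g(-g)`, while `(g(-g))^{ord g}` also equals `g^{ord g} (-g)^{ord g}`. An element of
infinite order is excluded by a sequence over `±g, ±(N+1)g`, and exponent 2 by the atom `a b (a+b)`.

Upper bound. Let `n` kill `G`, let `N ≥ n`, and let `A^N` have a unique length. The cross number is
the sum of the `1 / ord g`; if it is 1 on every atom over the support of `A`, then length equals
cross number and is unique. The defect, length minus cross number, is additive on zero-sum divisors
of `A^N` and vanishes on `g^{ord g}`. Reducing multiplicities modulo the orders extends it to all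
zero-sum sequences over the support, and additivity survives when the reduced sequences still fit
together into `A^N`. Suppose an atom `V` has minimal cross number `k < 1`, and the reduced defect is
linear up to a multiple `jV` that contains some full block `g^{ord g}`. Removing `c ≥ 1` such blocks
leaves a sequence of length `j - c` and cross number `jk - c < (j - c)k`, against minimality. So
cross numbers are at least 1, and passing to `(n-1)U`, which acts as `-U`, gives equality
(`crossNumber_eq_one`). Linearity can fail only at the last addition, and only at elements of order
`n`. It is rescued by negating `2U` when `n ≥ 7`, by adding copies of `A` when `n ≤ 6`, and in
cyclic groups by negating both summands, because there `A` contains only one element of order `n`.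
-/

lemma le_nsmul_singleton {α : Type*} {V : Multiset α} {m : ℕ} {g : α} (h : V ≤ m • {g}) :
    ∃ c ≤ m, V = c • {g} := by
  rw [Multiset.nsmul_singleton, Multiset.le_replicate_iff] at h
  obtain ⟨c, hc, rfl⟩ := h
  exact ⟨c, hc, by rw [Multiset.nsmul_singleton]⟩

lemma exists_le_nsmul {α : Type*} {A B : Multiset α} (h : B ⊆ A) : ∃ m : ℕ, B ≤ m • A := by
  classical
  refine ⟨B.card, Multiset.le_iff_count.2 fun g => ?_⟩
  rw [Multiset.count_nsmul]
  by_cases hg : g ∈ B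
  · have := Multiset.one_le_count_iff_mem.2 (h hg)
    have h2 := Multiset.count_le_card g B
    nlinarith
  · simp [Multiset.count_eq_zero_of_notMem hg]

/-! ### Zero-sum sequences, atoms and unique lengths -/

section Factorization

variable {G : Type*} [AddCommGroup G]

/-- Minimal zero-sum sequences. -/
def IsAtom (U : Multiset G) : Prop :=
  U ≠ 0 ∧ U.sum = 0 ∧ ∀ V W : Multiset G, V.sum = 0 → W.sum = 0 → V + W = U → V = 0 ∨ W = 0

/-- `F` is a factorization of `B` into minimal zero-sum sequences. -/
def IsFactorization (F : Multiset (Multiset G)) (B : Multiset G) : Prop :=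
  (∀ U ∈ F, IsAtom U) ∧ F.sum = B

/-- All factorizations of `B` have the same length. -/
def UniqueLength (B : Multiset G) : Prop :=
  ∀ F F', IsFactorization F B → IsFactorization F' B → F.card = F'.card

lemma IsFactorization.add {F F' : Multiset (Multiset G)} {B B' : Multiset G}
    (h : IsFactorization F B) (h' : IsFactorization F' B') : IsFactorization (F + F') (B + B') := by
  refine ⟨fun U hU => ?_, by rw [Multiset.sum_add, h.2, h'.2]⟩
  rcases Multiset.mem_add.1 hU with hU | hU
  exacts [h.1 U hU, h'.1 U hU]

lemma IsAtom.isFactorization {U : Multiset G} (h : IsAtom U) : IsFactorization {U} U :=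
  ⟨fun V hV => by rw [Multiset.mem_singleton.1 hV]; exact h, Multiset.sum_singleton U⟩

lemma IsFactorization.nsmul {F : Multiset (Multiset G)} {B : Multiset G}
    (h : IsFactorization F B) (m : ℕ) : IsFactorization (m • F) (m • B) := by
  induction m with
  | zero => exact ⟨by simp, by simp⟩
  | succ m ih => rw [succ_nsmul, succ_nsmul]; exact ih.add h

lemma IsFactorization.le {F : Multiset (Multiset G)} {B U : Multiset G}
    (h : IsFactorization F B) (hU : U ∈ F) : U ≤ B := by
  rw [← h.2]; exact Multiset.single_le_sum (fun _ _ => Multiset.zero_le _) U hU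

lemma IsFactorization.eq_zero {F : Multiset (Multiset G)} (h : IsFactorization F 0) : F = 0 := by
  by_contra hF
  obtain ⟨U, hU⟩ := Multiset.exists_mem_of_ne_zero hF
  exact (h.1 U hU).1 (Multiset.le_zero.1 (h.le hU))

lemma exists_isFactorization (B : Multiset G) (hB : B.sum = 0) : ∃ F, IsFactorization F B := by
  induction hc : B.card using Nat.strong_induction_on generalizing B with
  | _ c ih =>
    by_cases h0 : B = 0
    · exact ⟨0, by simp, by simp [h0]⟩
    by_cases ha : IsAtom B
    · exact ⟨_, ha.isFactorization⟩
    · simp only [IsAtom, not_and, not_forall, not_or] at ha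
      obtain ⟨V, W, hV, hW, rfl, hV0, hW0⟩ := ha h0 hB
      replace hV0 := Multiset.card_pos.2 hV0
      replace hW0 := Multiset.card_pos.2 hW0
      rw [Multiset.card_add] at hc
      obtain ⟨F, hF⟩ := ih V.card (by omega) V hV rfl
      obtain ⟨F', hF'⟩ := ih W.card (by omega) W hW rfl
      exact ⟨_, hF.add hF'⟩

lemma IsAtom.uniqueLength {U : Multiset G} (h : IsAtom U) : UniqueLength U := by
  have key : ∀ F, IsFactorization F U → F.card = 1 := by
    intro F hF
    obtain ⟨V, hV⟩ : ∃ V, V ∈ F := by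
      apply Multiset.exists_mem_of_ne_zero
      rintro rfl
      exact h.1 (by rw [← hF.2, Multiset.sum_zero])
    obtain ⟨F', rfl⟩ := Multiset.exists_cons_of_mem hV
    have hF' : IsFactorization F' F'.sum := ⟨fun W hW => hF.1 W (Multiset.mem_cons_of_mem hW), rfl⟩
    have hVat := hF.1 V (Multiset.mem_cons_self V F')
    have hs := hF.2
    rw [Multiset.sum_cons] at hs
    have h0 : F'.sum.sum = 0 := by
      have := congrArg Multiset.sum hs
      rwa [Multiset.sum_add, hVat.2.1, h.2.1, zero_add] at this
    rcases h.2.2 V F'.sum hVat.2.1 h0 hs with h1 | h1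
    · exact absurd h1 hVat.1
    · rw [h1] at hF'
      simp [hF'.eq_zero]
  intro F F' hF hF'
  rw [key F hF, key F' hF']

lemma sum_tsub {B C : Multiset G} (hBC : B ≤ C) (hB : B.sum = 0) (hC : C.sum = 0) :
    ∃ D, C = B + D ∧ D.sum = 0 := by
  obtain ⟨D, rfl⟩ := Multiset.le_iff_exists_add.1 hBC
  exact ⟨D, rfl, by rwa [Multiset.sum_add, hB, zero_add] at hC⟩

/-- Two factorizations of a divisor are padded by the same factorization of its complement. -/
lemma UniqueLength.of_le {B C : Multiset G} (h : UniqueLength C) (hC : C.sum = 0) (hBC : B ≤ C)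
    (hB : B.sum = 0) : UniqueLength B := by
  obtain ⟨D, rfl, hD⟩ := sum_tsub hBC hB hC
  obtain ⟨E, hE⟩ := exists_isFactorization D hD
  intro F F' hF hF'
  have := h _ _ (hF.add hE) (hF'.add hE)
  simpa using this

open Classical in
/-- The length of some factorization of `B`. -/
noncomputable def len (B : Multiset G) : ℕ :=
  if h : ∃ F, IsFactorization F B then h.choose.card else 0

lemma UniqueLength.len_eq {B : Multiset G} (h : UniqueLength B) {F : Multiset (Multiset G)}
    (hF : IsFactorization F B) : len B = F.card := by
  have hex : ∃ F, IsFactorization F B := ⟨F, hF⟩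
  rw [len, dif_pos hex]
  exact h _ _ hex.choose_spec hF

lemma UniqueLength.len_add {B C D : Multiset G} (h : UniqueLength D) (hD : D.sum = 0)
    (hle : B + C ≤ D) (hB : B.sum = 0) (hC : C.sum = 0) : len (B + C) = len B + len C := by
  have hBC := h.of_le hD hle (by rw [Multiset.sum_add, hB, hC, add_zero])
  have hs : (B + C).sum = 0 := by rw [Multiset.sum_add, hB, hC, add_zero]
  obtain ⟨F, hF⟩ := exists_isFactorization B hB
  obtain ⟨E, hE⟩ := exists_isFactorization C hC
  rw [hBC.len_eq (hF.add hE), (hBC.of_le hs (Multiset.le_add_right B C) hB).len_eq hF,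
    (hBC.of_le hs (Multiset.le_add_left C B) hC).len_eq hE, Multiset.card_add]

lemma UniqueLength.one_le_len {B : Multiset G} (h : UniqueLength B) (hB : B.sum = 0)
    (h0 : B ≠ 0) : 1 ≤ len B := by
  obtain ⟨F, hF⟩ := exists_isFactorization B hB
  rw [h.len_eq hF, Nat.one_le_iff_ne_zero, Ne, Multiset.card_eq_zero]
  rintro rfl
  exact h0 (by rw [← hF.2, Multiset.sum_zero])

lemma len_zero : len (0 : Multiset G) = 0 := by
  have h0 : IsFactorization (0 : Multiset (Multiset G)) 0 := ⟨by simp, by simp⟩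
  have hu : UniqueLength (0 : Multiset G) := by
    intro F F' hF hF'
    rw [hF.eq_zero, hF'.eq_zero]
  simpa using hu.len_eq h0

lemma isAtom_addOrderOf_nsmul {g : G} (hg : 0 < addOrderOf g) :
    IsAtom (addOrderOf g • ({g} : Multiset G)) := by
  refine ⟨fun h => ?_, by simp [Multiset.sum_nsmul, addOrderOf_nsmul_eq_zero], ?_⟩
  · have := congrArg Multiset.card h
    rw [Multiset.card_nsmul, Multiset.card_singleton, Multiset.card_zero] at this
    omega
  · intro V W hV hW hVW
    obtain ⟨c, hc, rfl⟩ := le_nsmul_singleton (hVW ▸ Multiset.le_add_right V W)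
    have hW' : W.card = addOrderOf g - c := by
      have := congrArg Multiset.card hVW
      simp at this
      omega
    rw [Multiset.sum_nsmul, Multiset.sum_singleton, ← addOrderOf_dvd_iff_nsmul_eq_zero] at hV
    rcases Nat.eq_zero_or_pos c with h0 | h0
    · left; simp [h0]
    · right
      rw [← Multiset.card_eq_zero, hW', Nat.sub_eq_zero_iff_le]
      exact Nat.le_of_dvd h0 hV

lemma two_le_card {V : Multiset G} (hV : V.sum = 0) (h0 : V ≠ 0) (hz : (0 : G) ∉ V) :
    2 ≤ V.card := by
  by_contra hlt
  have h1 : V.card = 1 := by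
    have := Multiset.card_pos.2 h0
    omega
  obtain ⟨a, rfl⟩ := Multiset.card_eq_one.1 h1
  rw [Multiset.sum_singleton] at hV
  simp [hV] at hz

/-- Without the element 0, two nonempty zero-sum parts need at least four elements. -/
lemma isAtom_of_card_le_three {U : Multiset G} (hU : U.sum = 0) (h0 : U ≠ 0) (hz : (0 : G) ∉ U)
    (hc : U.card ≤ 3) : IsAtom U := by
  refine ⟨h0, hU, fun V W hV hW hVW => ?_⟩
  by_contra! hne
  have h1 := two_le_card hV hne.1 fun h => hz (hVW ▸ Multiset.mem_add.2 (Or.inl h))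
  have h2 := two_le_card hW hne.2 fun h => hz (hVW ▸ Multiset.mem_add.2 (Or.inr h))
  rw [← hVW, Multiset.card_add] at hc
  omega

end Factorization

/-! ### Cross number and defect -/

section CrossNumber

variable {G : Type*} [AddCommGroup G]

/-- The cross number of a sequence. -/
noncomputable def crossNumber (B : Multiset G) : ℚ := (B.map fun g => (1 : ℚ) / addOrderOf g).sum

lemma crossNumber_zero : crossNumber (0 : Multiset G) = 0 := by simp [crossNumber]

lemma crossNumber_add (B C : Multiset G) : crossNumber (B + C) = crossNumber B + crossNumber C := by
  simp [crossNumber]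

lemma crossNumber_nsmul (m : ℕ) (B : Multiset G) : crossNumber (m • B) = m * crossNumber B := by
  simp [crossNumber, Multiset.map_nsmul, Multiset.sum_nsmul]

lemma crossNumber_singleton (g : G) : crossNumber {g} = 1 / addOrderOf g := by simp [crossNumber]

lemma crossNumber_nonneg (B : Multiset G) : 0 ≤ crossNumber B := by
  refine Multiset.sum_nonneg fun x hx => ?_
  obtain ⟨g, -, rfl⟩ := Multiset.mem_map.1 hx
  positivity

lemma crossNumber_mono {B C : Multiset G} (h : B ≤ C) : crossNumber B ≤ crossNumber C := by
  obtain ⟨D, rfl⟩ := Multiset.le_iff_exists_add.1 h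
  rw [crossNumber_add]
  linarith [crossNumber_nonneg D]

lemma crossNumber_sum (F : Multiset (Multiset G)) :
    crossNumber F.sum = (F.map crossNumber).sum := by
  induction F using Multiset.induction_on with
  | empty => simp [crossNumber_zero]
  | cons U F ih => simp [crossNumber_add, ih]

lemma crossNumber_addOrderOf_nsmul {g : G} (hg : 0 < addOrderOf g) :
    crossNumber (addOrderOf g • ({g} : Multiset G)) = 1 := by
  rw [crossNumber_nsmul, crossNumber_singleton]
  field_simp

/-- The difference between the length and the cross number. -/
noncomputable def defect (B : Multiset G) : ℚ := len B - crossNumber B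

lemma UniqueLength.defect_add {B C D : Multiset G} (h : UniqueLength D) (hD : D.sum = 0)
    (hle : B + C ≤ D) (hB : B.sum = 0) (hC : C.sum = 0) :
    defect (B + C) = defect B + defect C := by
  rw [defect, defect, defect, h.len_add hD hle hB hC, crossNumber_add]
  push_cast
  ring

lemma IsAtom.defect {U : Multiset G} (h : IsAtom U) : defect U = 1 - crossNumber U := by
  rw [ZeroSum.defect, h.uniqueLength.len_eq h.isFactorization]
  simp

lemma defect_zero : defect (0 : Multiset G) = 0 := by
  simp [defect, crossNumber_zero, len_zero]

lemma defect_addOrderOf_nsmul {g : G} (hg : 0 < addOrderOf g) :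
    defect (addOrderOf g • ({g} : Multiset G)) = 0 := by
  rw [(isAtom_addOrderOf_nsmul hg).defect, crossNumber_addOrderOf_nsmul hg, sub_self]

lemma count_lt_addOrderOf [DecidableEq G] {U : Multiset G} (hk : crossNumber U < 1)
    {g : G} (hg : 0 < addOrderOf g) : U.count g < addOrderOf g := by
  by_contra! hle
  have hle' : addOrderOf g • {g} ≤ U := by
    rwa [Multiset.nsmul_singleton, ← Multiset.le_count_iff_replicate_le]
  have := crossNumber_mono hle'
  rw [crossNumber_addOrderOf_nsmul hg] at this
  linarith

lemma count_div_add_count_div_le_crossNumber [DecidableEq G] (U : Multiset G) {g h : G}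
    (hgh : g ≠ h) :
    (U.count g : ℚ) / addOrderOf g + (U.count h : ℚ) / addOrderOf h ≤ crossNumber U := by
  have hle : U.count g • {g} + U.count h • {h} ≤ U := by
    refine Multiset.le_iff_count.2 fun a => ?_
    simp only [Multiset.count_add, Multiset.count_nsmul, Multiset.count_singleton]
    by_cases h1 : a = g
    · subst h1; simp [hgh]
    · by_cases h2 : a = h
      · subst h2; simp [h1]
      · simp [h1, h2]
  have := crossNumber_mono hle
  rwa [crossNumber_add, crossNumber_nsmul, crossNumber_singleton, mul_one_div, crossNumber_nsmul,
    crossNumber_singleton, mul_one_div] at this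

end CrossNumber

/-! ### Multiplicities modulo the orders -/

section Reduction

variable {G : Type*} [AddCommGroup G] [DecidableEq G]

/-- The sequence with multiplicities reduced modulo the orders of the elements. -/
noncomputable def reduce (B : Multiset G) : Multiset G :=
  ∑ g ∈ B.toFinset, (B.count g % addOrderOf g) • {g}

lemma count_reduce (B : Multiset G) (g : G) : (reduce B).count g = B.count g % addOrderOf g := by
  rw [reduce, Multiset.count_sum']
  simp only [Multiset.count_nsmul, Multiset.count_singleton, mul_ite, mul_one, mul_zero,
    Finset.sum_ite_eq, Multiset.mem_toFinset]
  split_ifs with h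
  · rfl
  · rw [Multiset.count_eq_zero_of_notMem h, Nat.zero_mod]

lemma reduce_congr {B C : Multiset G} (h : ∀ g, B.count g ≡ C.count g [MOD addOrderOf g]) :
    reduce B = reduce C := by
  ext g
  rw [count_reduce, count_reduce]
  exact h g

lemma sum_reduce (B : Multiset G) : (reduce B).sum = B.sum := by
  rw [Finset.sum_multiset_count B, reduce, ← Multiset.coe_sumAddMonoidHom, map_sum]
  refine Finset.sum_congr rfl fun g _ => ?_
  rw [Multiset.coe_sumAddMonoidHom, Multiset.sum_nsmul, Multiset.sum_singleton,
    mod_addOrderOf_nsmul]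

lemma reduce_eq_self {B : Multiset G} (h : ∀ g ∈ B, B.count g < addOrderOf g) : reduce B = B := by
  ext g
  rw [count_reduce]
  by_cases hg : g ∈ B
  · exact Nat.mod_eq_of_lt (h g hg)
  · rw [Multiset.count_eq_zero_of_notMem hg, Nat.zero_mod]

/-- The defect of the reduced sequence. -/
noncomputable def reducedDefect (B : Multiset G) : ℚ := defect (reduce B)

lemma reducedDefect_congr {B C : Multiset G}
    (h : ∀ g, B.count g ≡ C.count g [MOD addOrderOf g]) : reducedDefect B = reducedDefect C := by
  rw [reducedDefect, reduce_congr h, reducedDefect]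

/-- Below `D` the defect is additive, so splitting off the blocks `g^{ord g}`, which have defect 0,
does not change it. -/
lemma UniqueLength.reducedDefect_eq {D : Multiset G} (h : UniqueLength D) (hD : D.sum = 0)
    (ho : ∀ g : G, 0 < addOrderOf g) (B : Multiset G) (hB : B.sum = 0) (hBD : B ≤ D) :
    reducedDefect B = defect B := by
  induction hc : B.card using Nat.strong_induction_on generalizing B with
  | _ c ih =>
    by_cases hlt : ∀ g ∈ B, B.count g < addOrderOf g
    · rw [reducedDefect, reduce_eq_self hlt]
    · push Not at hlt
      obtain ⟨g, -, hg⟩ := hlt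
      have hle : addOrderOf g • {g} ≤ B := by
        rwa [Multiset.nsmul_singleton, ← Multiset.le_count_iff_replicate_le]
      obtain ⟨C, rfl, hC⟩ := sum_tsub hle (isAtom_addOrderOf_nsmul (ho g)).2.1 hB
      have hCD : C ≤ D := (Multiset.le_add_left _ _).trans hBD
      rw [h.defect_add hD hBD (isAtom_addOrderOf_nsmul (ho g)).2.1 hC,
        defect_addOrderOf_nsmul (ho g), zero_add, ← ih C.card ?_ C hC hCD rfl]
      · refine reducedDefect_congr fun a => ?_
        rw [Multiset.count_add, Multiset.count_nsmul, Multiset.count_singleton]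
        split_ifs with hag
        · subst hag; simp [Nat.ModEq]
        · simp [Nat.ModEq]
      · have := ho g
        simp at hc
        omega

/-- Each block `g^{ord g}` that is removed has cross number 1; `c` counts these blocks. -/
lemma crossNumber_eq_crossNumber_reduce_add (ho : ∀ g : G, 0 < addOrderOf g) (B : Multiset G) :
    ∃ c : ℕ, crossNumber B = crossNumber (reduce B) + c ∧
      ((∃ g, addOrderOf g ≤ B.count g) → 1 ≤ c) := by
  induction hc : B.card using Nat.strong_induction_on generalizing B with
  | _ c ih =>
    by_cases hlt : ∀ g ∈ B, B.count g < addOrderOf g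
    · refine ⟨0, by rw [reduce_eq_self hlt]; simp, ?_⟩
      rintro ⟨g, hg⟩
      have := hlt g (Multiset.one_le_count_iff_mem.1 ((ho g).trans_le hg))
      omega
    · push Not at hlt
      obtain ⟨g, -, hg⟩ := hlt
      have hle : addOrderOf g • {g} ≤ B := by
        rwa [Multiset.nsmul_singleton, ← Multiset.le_count_iff_replicate_le]
      obtain ⟨C, rfl⟩ := Multiset.le_iff_exists_add.1 hle
      obtain ⟨d, hd, -⟩ := ih C.card (by have := ho g; simp at hc; omega) C rfl
      refine ⟨d + 1, ?_, by omega⟩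
      have hr : reduce (addOrderOf g • {g} + C) = reduce C := by
        refine reduce_congr fun a => ?_
        rw [Multiset.count_add, Multiset.count_nsmul, Multiset.count_singleton]
        split_ifs with hag
        · subst hag; simp [Nat.ModEq]
        · simp [Nat.ModEq]
      rw [hr, crossNumber_add, crossNumber_addOrderOf_nsmul (ho g), hd]
      push_cast
      ring

end Reduction

/-! ### Additivity of the reduced defect and the cross number criterion -/

lemma addOrderOf_pos_of_nsmul {G : Type*} [AddCommGroup G] {n : ℕ}
    (hn : 0 < n) (hexp : ∀ g : G, n • g = 0) (g : G) :
    0 < addOrderOf g :=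
  Nat.pos_of_dvd_of_pos (addOrderOf_dvd_of_nsmul_eq_zero (hexp g)) hn

lemma sum_nsmul_eq_zero {G : Type*} [AddCommGroup G] {B : Multiset G}
    (hB : B.sum = 0) (m : ℕ) : (m • B).sum = 0 := by
  rw [Multiset.sum_nsmul, hB, nsmul_zero]

lemma nsmul_subset_of_subset {α : Type*} {A B : Multiset α} (h : B ⊆ A) (m : ℕ) : m • B ⊆ A :=
  fun _ hg => h (Multiset.mem_of_mem_nsmul hg)

/-- Modulo `o` the factor `n - 1` acts as `-1`, so the two residues add up to 0 or `o`. -/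
lemma mod_add_pred_mul_mod_le {o n : ℕ} (ho : o ∣ n) (hn : 0 < n) (a : ℕ) :
    a % o + ((n - 1) * a) % o ≤ o := by
  have hpos := Nat.pos_of_dvd_of_pos ho hn
  have h1 := Nat.mod_lt a hpos
  have h2 := Nat.mod_lt ((n - 1) * a) hpos
  have h3 : o ∣ a % o + ((n - 1) * a) % o := by
    rw [Nat.dvd_iff_mod_eq_zero, ← Nat.add_mod, ← Nat.dvd_iff_mod_eq_zero]
    have : a + (n - 1) * a = n * a := by
      obtain ⟨m, rfl⟩ := Nat.exists_eq_succ_of_ne_zero hn.ne'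
      simp; ring
    rw [this]
    exact ho.mul_right a
  obtain ⟨q, hq⟩ := h3
  have : q < 2 := by nlinarith
  nlinarith

lemma le_mul_count {α : Type*} [DecidableEq α] {A : Multiset α} {N : ℕ} {g : α}
    (hg : g ∈ A) {m : ℕ} (hm : m ≤ N) :
    m ≤ N * A.count g := by
  have := Multiset.one_le_count_iff_mem.2 hg
  nlinarith

lemma subset_of_le_nsmul {α : Type*} {A B : Multiset α} {m : ℕ} (h : B ≤ m • A) : B ⊆ A :=
  fun _ hg => Multiset.mem_of_mem_nsmul (Multiset.subset_of_le h hg)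

/-- The length of every factorization equals the cross number of `B`. -/
lemma uniqueLength_of_crossNumber_eq_one {G : Type*} [AddCommGroup G] {A : Multiset G}
    (h : ∀ U : Multiset G, IsAtom U → U ⊆ A → crossNumber U = 1) {B : Multiset G} (hBA : B ⊆ A) :
    UniqueLength B := by
  have key : ∀ F, IsFactorization F B → (F.card : ℚ) = crossNumber B := by
    intro F hF
    rw [← hF.2, crossNumber_sum, Multiset.map_congr rfl (g := fun _ => (1 : ℚ))]
    · simp
    · intro U hU
      exact h U (hF.1 U hU) fun g hg => hBA (Multiset.subset_of_le (hF.le hU) hg)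
  intro F F' hF hF'
  have := (key F hF).trans (key F' hF').symm
  exact_mod_cast this

section UpperBound

variable {G : Type*} [AddCommGroup G] [DecidableEq G] {n N : ℕ} {A : Multiset G}

/-- The hypothesis `h` says that the two reduced sequences together still divide `N • A`, where the
defect is additive. -/
lemma reducedDefect_add (hn : 0 < n) (hexp : ∀ g : G, n • g = 0) (hA : A.sum = 0)
    (hU : UniqueLength (N • A)) {B C : Multiset G} (hB : B.sum = 0) (hC : C.sum = 0)
    (hBA : B ⊆ A) (hCA : C ⊆ A)
    (h : ∀ g ∈ A, B.count g % addOrderOf g + C.count g % addOrderOf g ≤ N * A.count g) :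
    reducedDefect (B + C) = reducedDefect B + reducedDefect C := by
  have ho := addOrderOf_pos_of_nsmul hn hexp
  have hNA := sum_nsmul_eq_zero hA N
  have hle : reduce B + reduce C ≤ N • A := by
    refine Multiset.le_iff_count.2 fun g => ?_
    rw [Multiset.count_add, count_reduce, count_reduce, Multiset.count_nsmul]
    by_cases hg : g ∈ A
    · exact h g hg
    · rw [Multiset.count_eq_zero_of_notMem fun h => hg (hBA h),
        Multiset.count_eq_zero_of_notMem fun h => hg (hCA h)]
      simp
  have hrB : (reduce B).sum = 0 := by rw [sum_reduce, hB]
  have hrC : (reduce C).sum = 0 := by rw [sum_reduce, hC]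
  have h1 : reducedDefect (B + C) = reducedDefect (reduce B + reduce C) := by
    refine reducedDefect_congr fun g => ?_
    rw [Multiset.count_add, Multiset.count_add, count_reduce, count_reduce]
    exact ((Nat.mod_modEq _ _).add (Nat.mod_modEq _ _)).symm
  rw [h1, hU.reducedDefect_eq hNA ho _ (by rw [Multiset.sum_add, hrB, hrC, add_zero]) hle,
    hU.defect_add hNA hle hrB hrC, reducedDefect, reducedDefect]

lemma reducedDefect_nsmul_exponent (hexp : ∀ g : G, n • g = 0) (B : Multiset G) :
    reducedDefect (n • B) = 0 := by
  rw [reducedDefect_congr (C := 0), reducedDefect, reduce, Multiset.toFinset_zero,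
    Finset.sum_empty, defect_zero]
  intro g
  rw [Multiset.count_nsmul, Multiset.count_zero, Nat.modEq_zero_iff_dvd]
  exact (addOrderOf_dvd_of_nsmul_eq_zero (hexp g)).mul_right _

/-- The residues of `B` and `(n - 1) • B` add up to at most the order, hence to at most `N`, so the
two reduced defects add up to that of `n • B`, which is 0. -/
lemma reducedDefect_pred_nsmul (hn : 0 < n) (hexp : ∀ g : G, n • g = 0) (hA : A.sum = 0)
    (hU : UniqueLength (N • A)) (hnN : n ≤ N) {B : Multiset G} (hB : B.sum = 0) (hBA : B ⊆ A) :
    reducedDefect ((n - 1) • B) = - reducedDefect B := by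
  have h := reducedDefect_add hn hexp hA hU hB (sum_nsmul_eq_zero hB (n - 1)) hBA
    (nsmul_subset_of_subset hBA _) fun g hg => by
      have hd := addOrderOf_dvd_of_nsmul_eq_zero (hexp g)
      rw [Multiset.count_nsmul]
      exact le_mul_count hg ((mod_add_pred_mul_mod_le hd hn _).trans
        ((Nat.le_of_dvd hn hd).trans hnN))
  have hs : B + (n - 1) • B = n • B := by
    rw [← succ_nsmul', Nat.sub_add_cancel hn]
  rw [hs, reducedDefect_nsmul_exponent hexp] at h
  linarith

lemma reducedDefect_atom (ho : ∀ g : G, 0 < addOrderOf g) {U : Multiset G} (h : IsAtom U) :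
    reducedDefect U = 1 - crossNumber U := by
  rw [h.uniqueLength.reducedDefect_eq h.2.1 ho U h.2.1 le_rfl, h.defect]

/-- If the defect is the multiple that one expects on suitable multiples of the atoms with small
cross number, then all atoms have cross number one. -/
lemma crossNumber_eq_one (hn : 0 < n) (hexp : ∀ g : G, n • g = 0) (hA : A.sum = 0)
    (hU : UniqueLength (N • A)) (hnN : n ≤ N)
    (hmul : ∀ U, IsAtom U → U ⊆ A → crossNumber U < 1 → ∃ j : ℕ,
      reducedDefect (j • U) = j * reducedDefect U ∧ ∃ g, addOrderOf g ≤ j * U.count g)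
    {U : Multiset G} (hat : IsAtom U) (hUA : U ⊆ A) : crossNumber U = 1 := by
  have ho := addOrderOf_pos_of_nsmul hn hexp
  have hNA := sum_nsmul_eq_zero hA N
  have hred : ∀ B : Multiset G, B ⊆ A → reduce B ≤ N • A := by
    intro B hB
    refine Multiset.le_iff_count.2 fun g => ?_
    rw [count_reduce, Multiset.count_nsmul]
    by_cases hg : g ∈ A
    · exact le_mul_count hg ((Nat.mod_lt _ (ho g)).le.trans
        ((Nat.le_of_dvd hn (addOrderOf_dvd_of_nsmul_eq_zero (hexp g))).trans hnN))
    · simp [Multiset.count_eq_zero_of_notMem fun h => hg (hB h)]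
  -- all cross numbers of atoms are at least one
  have hge : ∀ V, IsAtom V → V ⊆ A → 1 ≤ crossNumber V := by
    by_contra! hex
    -- Cross number below 1 keeps every multiplicity below the order, so these atoms all divide `N •
    -- A`.
    have hfin : {V : Multiset G | IsAtom V ∧ V ⊆ A ∧ crossNumber V < 1}.Finite := by
      refine (Set.finite_Iic (N • A)).subset ?_
      rintro V ⟨-, hVA, hk⟩
      have := hred V hVA
      rwa [reduce_eq_self fun g _ => count_lt_addOrderOf hk (ho g)] at this
    obtain ⟨V, ⟨hV, hVA, hk⟩, hmin⟩ :=
      Set.exists_min_image _ crossNumber hfin hex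
    replace hmin : ∀ W, IsAtom W → W ⊆ A → crossNumber V ≤ crossNumber W := by
      intro W hW hWA
      by_cases hWk : crossNumber W < 1
      · exact hmin W ⟨hW, hWA, hWk⟩
      · linarith
    obtain ⟨j, hj, hg⟩ := hmul V hV hVA hk
    have hjA : j • V ⊆ A := nsmul_subset_of_subset hVA j
    have hs : (reduce (j • V)).sum = 0 := by
      rw [sum_reduce]; exact sum_nsmul_eq_zero hV.2.1 j
    obtain ⟨F, hF⟩ := exists_isFactorization _ hs
    obtain ⟨c, hc, hc1⟩ := crossNumber_eq_crossNumber_reduce_add ho (j • V)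
    have hc1 : (1 : ℚ) ≤ c := by
      have := hc1 (by obtain ⟨g, hg⟩ := hg; exact ⟨g, by rwa [Multiset.count_nsmul]⟩)
      exact_mod_cast this
    have hlen := (hU.of_le hNA (hred _ hjA) hs).len_eq hF
    rw [reducedDefect, defect, hlen, reducedDefect_atom ho hV] at hj
    rw [crossNumber_nsmul] at hc
    have hsum : F.card * crossNumber V ≤ crossNumber (reduce (j • V)) := by
      rw [← hF.2, crossNumber_sum, ← nsmul_eq_mul]
      have := Multiset.card_nsmul_le_sum (s := F.map crossNumber) (a := crossNumber V) ?_
      · rwa [Multiset.card_map] at this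
      · intro x hx
        obtain ⟨W, hW, rfl⟩ := Multiset.mem_map.1 hx
        exact hmin W (hF.1 W hW) (subset_of_le_nsmul ((hF.le hW).trans (hred _ hjA)))
    -- Linearity of the reduced defect makes the `c` removed blocks cost exactly `c` factors; with
    -- minimality this yields `c ≤ c * crossNumber V`, which is impossible.
    have hcard : (F.card : ℚ) = j - c := by linarith
    rw [hcard] at hsum
    nlinarith
  refine le_antisymm ?_ (hge U hat hUA)
  -- This reduced defect is `crossNumber U - 1`. It cannot be positive, since all factors of the
  -- reduced sequence have cross number at least 1.
  have hneg := reducedDefect_pred_nsmul hn hexp hA hU hnN hat.2.1 hUA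
  have hjA : (n - 1) • U ⊆ A := nsmul_subset_of_subset hUA _
  have hs : (reduce ((n - 1) • U)).sum = 0 := by
    rw [sum_reduce]; exact sum_nsmul_eq_zero hat.2.1 _
  obtain ⟨F, hF⟩ := exists_isFactorization _ hs
  have hlen := (hU.of_le hNA (hred _ hjA) hs).len_eq hF
  rw [reducedDefect, defect, hlen, reducedDefect_atom ho hat] at hneg
  have hsum : F.card * 1 ≤ crossNumber (reduce ((n - 1) • U)) := by
    rw [← hF.2, crossNumber_sum, ← nsmul_eq_mul]
    have := Multiset.card_nsmul_le_sum (s := F.map crossNumber) (a := 1) ?_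
    · rwa [Multiset.card_map] at this
    · intro x hx
      obtain ⟨W, hW, rfl⟩ := Multiset.mem_map.1 hx
      exact hge W (hF.1 W hW) (subset_of_le_nsmul ((hF.le hW).trans (hred _ hjA)))
  linarith

/-- The first multiple of an atom in which the multiplicity of some element reaches its order. -/
lemma exists_minimal_multiple (hn : 0 < n) (hexp : ∀ g : G, n • g = 0) (hA : A.sum = 0)
    (hU : UniqueLength (N • A)) (hnN : n ≤ N) {U : Multiset G} (hat : IsAtom U) (hUA : U ⊆ A)
    (hk : crossNumber U < 1) :
    ∃ i : ℕ, 1 ≤ i ∧ (∀ g, i * U.count g < addOrderOf g) ∧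
      (∃ g, addOrderOf g ≤ (i + 1) * U.count g) ∧
      reducedDefect (i • U) = i * reducedDefect U := by
  classical
  have ho := addOrderOf_pos_of_nsmul hn hexp
  have hex : ∃ i : ℕ, ∃ g, addOrderOf g ≤ (i + 1) * U.count g := by
    obtain ⟨g, hg⟩ := Multiset.exists_mem_of_ne_zero hat.1
    refine ⟨addOrderOf g, g, ?_⟩
    have := Multiset.one_le_count_iff_mem.2 hg
    nlinarith
  have hlt : ∀ i, i ≤ Nat.find hex → ∀ g, i * U.count g < addOrderOf g := by
    intro i hi g
    cases i with
    | zero => simpa using ho g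
    | succ i =>
      have := Nat.find_min hex (m := i) (by omega)
      push Not at this
      exact this g
  -- Up to this index no multiplicity reaches its order, so the sums stay below `n ≤ N`.
  have hlin : ∀ i, i ≤ Nat.find hex → reducedDefect (i • U) = i * reducedDefect U := by
    intro i
    induction i with
    | zero =>
      intro
      have := reducedDefect_nsmul_exponent hexp (0 : Multiset G)
      rw [nsmul_zero] at this
      simp [this]
    | succ i ih =>
      intro hi
      rw [succ_nsmul, reducedDefect_add hn hexp hA hU (sum_nsmul_eq_zero hat.2.1 i) hat.2.1
        (nsmul_subset_of_subset hUA i) hUA, ih (by omega)]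
      · push_cast; ring
      · intro g hg
        have h1 := hlt (i + 1) hi g
        have h2 := Nat.le_of_dvd hn (addOrderOf_dvd_of_nsmul_eq_zero (hexp g))
        refine le_mul_count hg ?_
        rw [Multiset.count_nsmul]
        have h3 := Nat.mod_le (i * U.count g) (addOrderOf g)
        have h4 := Nat.mod_le (U.count g) (addOrderOf g)
        rw [add_mul, one_mul] at h1
        omega
  refine ⟨Nat.find hex, ?_, hlt _ le_rfl, Nat.find_spec hex, hlin _ le_rfl⟩
  rw [Nat.one_le_iff_ne_zero, Ne, Nat.find_eq_zero]
  rintro ⟨g, hg⟩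
  have := count_lt_addOrderOf hk (ho g)
  omega

end UpperBound

/-! ### Upper bounds for large exponents, small exponents and cyclic groups -/

lemma two_mul_le_of_dvd_of_lt {o n : ℕ} (h : o ∣ n) (hlt : o < n) : 2 * o ≤ n := by
  obtain ⟨q, rfl⟩ := h
  have : q ≠ 0 := by rintro rfl; simp at hlt
  have : q ≠ 1 := by rintro rfl; simp at hlt
  have : 2 ≤ q := by omega
  nlinarith

/-- A proper divisor of `n` is at most `n / 2`; hence only elements of order exactly `n` can
obstruct additivity. -/
lemma mod_add_mod_le_of_dvd_of_ne {o n : ℕ} (h : o ∣ n) (hn : 0 < n) (hne : o ≠ n) (a b : ℕ) :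
    a % o + b % o ≤ n := by
  have h1 := two_mul_le_of_dvd_of_lt h (lt_of_le_of_ne (Nat.le_of_dvd hn h) hne)
  have hpos := Nat.pos_of_dvd_of_pos h hn
  have h2 := Nat.mod_lt a hpos
  have h3 := Nat.mod_lt b hpos
  omega

lemma defect_nsmul_of_le {G : Type*} [AddCommGroup G] {A : Multiset G} {N : ℕ}
    (hA : A.sum = 0) (hU : UniqueLength (N • A)) {m : ℕ} (hm : m ≤ N) :
    defect (m • A) = m * defect A := by
  induction m with
  | zero => simp [defect_zero]
  | succ m ih =>
    rw [succ_nsmul, hU.defect_add (sum_nsmul_eq_zero hA N) _ (sum_nsmul_eq_zero hA m) hA,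
      ih (by omega)]
    · push_cast; ring
    · rw [← succ_nsmul]
      exact nsmul_le_nsmul_left (Multiset.zero_le A) hm

lemma mem_zmultiples_of_addOrderOf_eq {G : Type*} [AddCommGroup G] [IsAddCyclic G] {n : ℕ}
    (hn : 0 < n) (hexp : ∀ g : G, n • g = 0) {g : G} (hg : addOrderOf g = n) (h : G) :
    h ∈ AddSubgroup.zmultiples g := by
  obtain ⟨x, hx⟩ := IsAddCyclic.exists_generator (α := G)
  have hcard := addOrderOf_eq_card_of_forall_mem_zmultiples hx
  have hdvd := addOrderOf_dvd_of_nsmul_eq_zero (hexp x)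
  have hfin : Finite G := Nat.finite_of_card_ne_zero (by
    rw [← hcard]
    exact (Nat.pos_of_dvd_of_pos hdvd hn).ne')
  have htop : AddSubgroup.zmultiples g = ⊤ := by
    apply AddSubgroup.eq_top_of_le_card
    rw [Nat.card_zmultiples, hg, ← hcard]
    exact Nat.le_of_dvd hn hdvd
  rw [htop]
  exact AddSubgroup.mem_top h

section UpperBound

variable {G : Type*} [AddCommGroup G] [DecidableEq G] {n N : ℕ} {A : Multiset G}

lemma count_add_count_lt (hn : 0 < n) {U : Multiset G} (hk : crossNumber U < 1) {g h : G}
    (hgh : g ≠ h) (hg : addOrderOf g = n) (hh : addOrderOf h = n) :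
    U.count g + U.count h < n := by
  have := (count_div_add_count_div_le_crossNumber U hgh).trans_lt hk
  rw [hg, hh, ← add_div, div_lt_one (by exact_mod_cast hn)] at this
  exact_mod_cast this

/-- An atom with cross number less than one contains no element of maximal order with the
largest conceivable multiplicity. -/
lemma count_add_one_lt (hexp : ∀ g : G, n • g = 0) (hn : 2 ≤ n) {U : Multiset G}
    (hat : IsAtom U) (hk : crossNumber U < 1) {g : G} (hg : addOrderOf g = n) :
    U.count g + 1 < n := by
  have hlt : U.count g < n := by
    simpa [hg] using count_lt_addOrderOf hk (g := g) (by omega)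
  by_contra hge
  have hc : U.count g = n - 1 := by omega
  -- Multiplicity `n - 1` contributes `(n - 1) / n`, and any other element contributes at least `1 /
  -- n`.
  have hall : ∀ h ∈ U, h = g := by
    intro h hh
    by_contra hne
    have ho := addOrderOf_pos_of_nsmul (by omega) hexp h
    have h1 := (count_div_add_count_div_le_crossNumber U (Ne.symm hne)).trans_lt hk
    have h2 := Multiset.one_le_count_iff_mem.2 hh
    have h3 : (1 : ℚ) / n ≤ (U.count h : ℚ) / addOrderOf h := by
      apply div_le_div₀ (by positivity) (by exact_mod_cast h2) (by exact_mod_cast ho)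
      exact_mod_cast Nat.le_of_dvd (by omega) (addOrderOf_dvd_of_nsmul_eq_zero (hexp h))
    rw [hg, hc, Nat.cast_sub (by omega)] at h1
    have h4 : ((n : ℚ) - (1 : ℕ)) / n + 1 / n = 1 := by
      have : (n : ℚ) ≠ 0 := by positivity
      field_simp
      push_cast; ring
    linarith
  have hs := hat.2.1
  rw [Multiset.eq_replicate_card.2 hall, Multiset.sum_replicate,
    ← addOrderOf_dvd_iff_nsmul_eq_zero, hg, ← Multiset.count_eq_card.2 fun h hh => (hall h hh).symm,
    hc] at hs
  have := Nat.le_of_dvd (by omega) hs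
  omega

/-- The bound for large exponents. -/
theorem uniqueLength_of_seven_le (hn : 7 ≤ n) (hexp : ∀ g : G, n • g = 0) (hA : A.sum = 0)
    (hU : UniqueLength (((3 * n - 3) / 2) • A)) {B : Multiset G} (hBA : B ⊆ A) :
    UniqueLength B := by
  obtain ⟨N, hN⟩ : ∃ N, N = (3 * n - 3) / 2 := ⟨_, rfl⟩
  rw [← hN] at hU
  have hn0 : 0 < n := by omega
  have hnN : n ≤ N := by omega
  refine uniqueLength_of_crossNumber_eq_one (fun U => crossNumber_eq_one hn0 hexp hA hU hnN ?_) hBA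
  intro U hat hUA hk
  obtain ⟨i, hi, hlt, hge, hlin⟩ := exists_minimal_multiple hn0 hexp hA hU hnN hat hUA hk
  refine ⟨i + 1, ?_, hge⟩
  have hd := fun g => addOrderOf_dvd_of_nsmul_eq_zero (hexp g)
  by_cases hgood : ∀ g ∈ A,
      (i • U).count g % addOrderOf g + U.count g % addOrderOf g ≤ N * A.count g
  · rw [succ_nsmul, reducedDefect_add hn0 hexp hA hU (sum_nsmul_eq_zero hat.2.1 i) hat.2.1
      (nsmul_subset_of_subset hUA i) hUA hgood, hlin]
    push_cast; ring
  push Not at hgood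
  obtain ⟨h, hh, hbad⟩ := hgood
  have hbad' : N < (i • U).count h % addOrderOf h + U.count h % addOrderOf h := by
    by_contra! hle
    exact absurd (le_mul_count hh hle) (by omega)
  have hoh : addOrderOf h = n := by
    by_contra hne
    have := mod_add_mod_le_of_dvd_of_ne (hd h) hn0 hne ((i • U).count h) (U.count h)
    omega
  have hxh := hlt h
  rw [Multiset.count_nsmul, Nat.mod_eq_of_lt hxh, hoh] at hbad'
  rw [hoh] at hxh
  have hxn := Nat.mod_le (U.count h) n
  -- For `i ≥ 2` the multiplicity is at most `(n - 1) / 2`, so the sum is at most `3 (n - 1) / 2`: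
  -- this is the source of the constant.
  have hi1 : i = 1 := by
    by_contra hne
    have : 2 * U.count h ≤ i * U.count h := Nat.mul_le_mul_right _ (by omega)
    omega
  subst hi1
  rw [one_mul] at hbad' hxh
  -- The sum `U + 2U` is avoided or not needed: adding `U` to the negative of `2U` gives the
  -- negative of `U`, and so the reduced defect of `2U`.
  have key := reducedDefect_add hn0 hexp hA hU (B := U) (C := (n - 1) • (2 • U)) hat.2.1
    (sum_nsmul_eq_zero (sum_nsmul_eq_zero hat.2.1 _) _) hUA
    (nsmul_subset_of_subset (nsmul_subset_of_subset hUA _) _) ?_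
  · have h1 : reducedDefect (U + (n - 1) • (2 • U)) = reducedDefect ((n - 1) • U) := by
      refine reducedDefect_congr fun g => ?_
      rw [Multiset.count_add, Multiset.count_nsmul, Multiset.count_nsmul, Multiset.count_nsmul]
      have : U.count g + (n - 1) * (2 * U.count g) = (n - 1) * U.count g + n * U.count g := by
        obtain ⟨m, rfl⟩ := Nat.exists_eq_succ_of_ne_zero hn0.ne'
        simp; ring
      rw [this]
      simpa using (Nat.ModEq.refl ((n - 1) * U.count g)).add
        (Nat.modEq_zero_iff_dvd.2 ((hd g).mul_right (U.count g)))
    rw [h1, reducedDefect_pred_nsmul hn0 hexp hA hU hnN hat.2.1 hUA,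
      reducedDefect_pred_nsmul hn0 hexp hA hU hnN (sum_nsmul_eq_zero hat.2.1 _)
      (nsmul_subset_of_subset hUA _)] at key
    push_cast
    linarith
  · intro g hg
    refine le_mul_count hg ?_
    by_cases hog : addOrderOf g = n
    · have hm := mod_add_pred_mul_mod_le (hd g) hn0 (2 * U.count g)
      have hx := hlt g
      rw [Multiset.count_nsmul, Multiset.count_nsmul]
      rw [hog] at hm hx ⊢
      rw [one_mul] at hx
      rw [Nat.mod_eq_of_lt hx]
      by_cases hgh : g = h
      · subst hgh
        -- The residues add up to at most `2n - x` with `x` the multiplicity of `h`; as `2x > N`,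
        -- this is at most `N` once `n ≥ 7`.
        have h2 : (2 * U.count g) % n = 2 * U.count g - n := by
          rw [Nat.mod_eq_sub_mod (by omega), Nat.mod_eq_of_lt (by omega)]
        omega
      · have := count_add_count_lt hn0 hk hgh hog hoh
        have h2 : (2 * U.count g) % n = 2 * U.count g := Nat.mod_eq_of_lt (by omega)
        omega
    · exact (mod_add_mod_le_of_dvd_of_ne (hd g) hn0 hog _ _).trans hnN

/-- Here `n` times the defect of `A` is the reduced defect of `n • A`, which is 0, so copies of `A`
can be added freely. -/
lemma reducedDefect_add_nsmul (hn : 0 < n) (hexp : ∀ g : G, n • g = 0) (hA : A.sum = 0)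
    (hU : UniqueLength (n • A)) {B : Multiset G} (hB : B.sum = 0) (hBA : B ⊆ A) (c : ℕ) :
    reducedDefect (B + c • A) = reducedDefect B := by
  have ho := addOrderOf_pos_of_nsmul hn hexp
  have hnA := sum_nsmul_eq_zero hA n
  have hdA : defect A = 0 := by
    have h1 := defect_nsmul_of_le hA hU le_rfl
    rw [← hU.reducedDefect_eq hnA ho _ hnA le_rfl, reducedDefect_nsmul_exponent hexp] at h1
    have : (n : ℚ) ≠ 0 := by positivity
    simpa [this] using h1.symm
  have hone : ∀ C : Multiset G, C.sum = 0 → C ⊆ A → reducedDefect (C + A) = reducedDefect C := by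
    intro C hC hCA
    have hle : reduce C + A ≤ n • A := by
      refine Multiset.le_iff_count.2 fun g => ?_
      rw [Multiset.count_add, count_reduce, Multiset.count_nsmul]
      by_cases hg : g ∈ A
      · have h1 := Multiset.one_le_count_iff_mem.2 hg
        have h2 := Nat.le_of_dvd hn (addOrderOf_dvd_of_nsmul_eq_zero (hexp g))
        have h3 := Nat.mod_lt (C.count g) (ho g)
        obtain ⟨m, rfl⟩ := Nat.exists_eq_succ_of_ne_zero hn.ne'
        have : C.count g % addOrderOf g ≤ m := by omega
        simp only [Nat.succ_eq_add_one, add_mul, one_mul]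
        nlinarith
      · rw [Multiset.count_eq_zero_of_notMem fun h => hg (hCA h), Nat.zero_mod, zero_add]
        exact Nat.le_mul_of_pos_left _ hn
    have hs : (reduce C).sum = 0 := by rw [sum_reduce, hC]
    have h1 : reducedDefect (C + A) = reducedDefect (reduce C + A) := by
      refine reducedDefect_congr fun g => ?_
      rw [Multiset.count_add, Multiset.count_add, count_reduce]
      exact ((Nat.mod_modEq _ _).add rfl).symm
    rw [h1, hU.reducedDefect_eq hnA ho _ (by rw [Multiset.sum_add, hs, hA, add_zero]) hle,
      hU.defect_add hnA hle hs hA, hdA, add_zero, reducedDefect]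
  induction c with
  | zero => simp
  | succ c ih =>
    rw [succ_nsmul, ← add_assoc, hone _ _ _, ih]
    · rw [Multiset.sum_add, hB, sum_nsmul_eq_zero hA, add_zero]
    · intro g hg
      rcases Multiset.mem_add.1 hg with hg | hg
      exacts [hBA hg, Multiset.mem_of_mem_nsmul hg]

/-- Four copies of `g` contribute `2/3`, which leaves room for at most one more element. That
element would be `-4g`, which has order dividing 3 and contributes at least `1/3`. -/
lemma count_ne_four (hexp : ∀ g : G, 6 • g = 0) {U : Multiset G}
    (hat : IsAtom U) (hk : crossNumber U < 1) {g : G} (hg : addOrderOf g = 6) :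
    U.count g ≠ 4 := by
  intro hc
  have ho := addOrderOf_pos_of_nsmul (by norm_num) hexp
  have hinv : ∀ h : G, (1 : ℚ) / 6 ≤ 1 / addOrderOf h := fun h => by
    apply one_div_le_one_div_of_le (by exact_mod_cast ho h)
    exact_mod_cast Nat.le_of_dvd (by norm_num) (addOrderOf_dvd_of_nsmul_eq_zero (hexp h))
  have hle : 4 • {g} ≤ U := by
    rw [Multiset.nsmul_singleton, ← Multiset.le_count_iff_replicate_le, hc]
  obtain ⟨W, rfl⟩ := Multiset.le_iff_exists_add.1 hle
  have hs := hat.2.1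
  rw [Multiset.sum_add, Multiset.sum_nsmul, Multiset.sum_singleton] at hs
  rw [crossNumber_add, crossNumber_nsmul, crossNumber_singleton, hg] at hk
  by_cases hW : W = 0
  · subst hW
    rw [Multiset.sum_zero, add_zero, ← addOrderOf_dvd_iff_nsmul_eq_zero, hg] at hs
    omega
  obtain ⟨h, hh⟩ := Multiset.exists_mem_of_ne_zero hW
  obtain ⟨W', rfl⟩ := Multiset.exists_cons_of_mem hh
  rw [← Multiset.singleton_add, crossNumber_add, crossNumber_singleton] at hk
  have hW' : W' = 0 := by
    by_contra hne
    obtain ⟨h', hh'⟩ := Multiset.exists_mem_of_ne_zero hne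
    have := crossNumber_mono (Multiset.singleton_le.2 hh')
    rw [crossNumber_singleton] at this
    have h1 := hinv h
    have h2 := hinv h'
    push_cast at hk
    linarith
  subst hW'
  rw [crossNumber_zero] at hk
  rw [Multiset.sum_cons, Multiset.sum_zero, add_zero] at hs
  have h3 : 3 • h = 0 := by
    have : 3 • h = 3 • (4 • g + h) - 2 • (6 • g) := by abel
    rw [this, hs, hexp]; simp
  have h4 : (1 : ℚ) / 3 ≤ 1 / addOrderOf h := by
    apply one_div_le_one_div_of_le (by exact_mod_cast ho h)
    exact_mod_cast Nat.le_of_dvd (by norm_num) (addOrderOf_dvd_of_nsmul_eq_zero h3)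
  push_cast at hk
  linarith

/-- The bound for small exponents. -/
theorem uniqueLength_of_le_six (hn : 0 < n) (hn6 : n ≤ 6) (hexp : ∀ g : G, n • g = 0)
    (hA : A.sum = 0) (hU : UniqueLength (n • A)) {B : Multiset G} (hBA : B ⊆ A) :
    UniqueLength B := by
  refine uniqueLength_of_crossNumber_eq_one
    (fun U => crossNumber_eq_one hn hexp hA hU le_rfl ?_) hBA
  intro U hat hUA hk
  obtain ⟨i, hi, hlt, hge, hlin⟩ := exists_minimal_multiple hn hexp hA hU le_rfl hat hUA hk
  refine ⟨i + 1, ?_, hge⟩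
  have hd := fun g => addOrderOf_dvd_of_nsmul_eq_zero (hexp g)
  by_cases hgood : ∀ g ∈ A,
      (i • U).count g % addOrderOf g + U.count g % addOrderOf g ≤ n * A.count g
  · rw [succ_nsmul, reducedDefect_add hn hexp hA hU (sum_nsmul_eq_zero hat.2.1 i) hat.2.1
      (nsmul_subset_of_subset hUA i) hUA hgood, hlin]
    push_cast; ring
  push Not at hgood
  obtain ⟨h, hh, hbad⟩ := hgood
  have hbad' : n < (i • U).count h % addOrderOf h + U.count h % addOrderOf h := by
    by_contra! hle
    exact absurd (le_mul_count hh hle) (by omega)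
  have hoh : addOrderOf h = n := by
    by_contra hne
    have := mod_add_mod_le_of_dvd_of_ne (hd h) hn hne ((i • U).count h) (U.count h)
    omega
  have hxh := hlt h
  rw [Multiset.count_nsmul, Nat.mod_eq_of_lt hxh, hoh] at hbad'
  rw [hoh] at hxh
  have hxn := Nat.mod_le (U.count h) n
  have hn1 : n ≠ 1 := by
    rintro rfl
    simp only [Nat.mod_one] at hbad'
    omega
  have htop := count_add_one_lt hexp (by omega) hat hk hoh
  have hsix : n = 6 → U.count h ≠ 4 := by
    rintro rfl
    exact count_ne_four hexp hat hk hoh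
  -- The bounds on the multiplicity of `h` leave only exponent 5.
  have hn5 : n = 5 ∧ (i = 2 ∨ i = 1 ∧ U.count h = 3) := by
    generalize U.count h = x at *
    have hx : x < 5 := by omega
    interval_cases x <;> omega
  obtain ⟨rfl, hi'⟩ := hn5
  -- If `h` occurs once in `A`, then `c` copies of `A` bring its multiplicity in `i • U` to 5, that
  -- is, to residue 0, and the other residues still fit.
  obtain ⟨c, hc⟩ : ∃ c, c = 3 - i := ⟨_, rfl⟩
  have hsub : i • U + c • A ⊆ A := by
    intro g hg
    rcases Multiset.mem_add.1 hg with hg | hg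
    exacts [nsmul_subset_of_subset hUA _ hg, Multiset.mem_of_mem_nsmul hg]
  have hiU := sum_nsmul_eq_zero hat.2.1 i
  have key := reducedDefect_add hn hexp hA hU (B := i • U + c • A) (C := U)
    (by rw [Multiset.sum_add, hiU, sum_nsmul_eq_zero hA, add_zero]) hat.2.1 hsub hUA ?_
  · rw [add_right_comm, ← succ_nsmul, reducedDefect_add_nsmul hn hexp hA hU
      (sum_nsmul_eq_zero hat.2.1 _) (nsmul_subset_of_subset hUA _),
      reducedDefect_add_nsmul hn hexp hA hU hiU (nsmul_subset_of_subset hUA _), hlin] at key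
    rw [key]
    push_cast; ring
  · intro g hg
    have ha := Multiset.one_le_count_iff_mem.2 hg
    rw [Multiset.count_add, Multiset.count_nsmul, Multiset.count_nsmul]
    by_cases hog : addOrderOf g = 5
    · have hx := hlt g
      rw [hog] at hx ⊢
      by_cases ha1 : A.count g = 1
      · rw [ha1]
        rcases hi' with rfl | ⟨rfl, hx3⟩
        · have hx2 : U.count g ≤ 2 := by omega
          generalize U.count g = x at hx2 ⊢
          subst hc
          interval_cases x <;> simp
        · by_cases hgh : g = h
          · rw [hgh, hx3, hc]
            norm_num
          · have hx1 : U.count g ≤ 1 := by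
              have := count_add_count_lt hn hk hgh hog hoh
              omega
            generalize U.count g = x at hx1 ⊢
            subst hc
            interval_cases x <;> simp
      · omega
    · exact le_mul_count hg (mod_add_mod_le_of_dvd_of_ne (hd g) hn hog _ _)

/-- If `h = bg` with `2 ≤ b < n`, then `g^n h^n` has a factorization of length 2 but also splits
into three nonempty zero-sum sequences. -/
lemma addOrderOf_ne_of_zmultiples (hn : 0 < n) (hA : A.sum = 0) (hU : UniqueLength (n • A))
    {g h : G} (hgA : g ∈ A) (hhA : h ∈ A) (hg : addOrderOf g = n)
    (hh : addOrderOf h = n) (hgh : h ∈ AddSubgroup.zmultiples g) : g = h := by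
  by_contra hne
  have hfin : IsOfFinAddOrder g := addOrderOf_pos_iff.1 (by omega)
  obtain ⟨b, hbn, hb⟩ : ∃ b < n, b • g = h := by
    obtain ⟨b, hb⟩ := (hfin.mem_multiples_iff_mem_zmultiples).2 hgh
    exact ⟨b % n, Nat.mod_lt _ hn, by rw [← hg, mod_addOrderOf_nsmul]; exact hb⟩
  have hb1 : b ≠ 1 := by rintro rfl; simp at hb; exact hne hb
  have hb0 : b ≠ 0 := by
    rintro rfl
    rw [zero_nsmul] at hb
    rw [← hb, addOrderOf_zero] at hh
    rw [← hh, AddMonoid.addOrderOf_eq_one_iff] at hg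
    exact hne (hg.trans hb)
  -- The largest `j` with `jb < n`. The three parts are `h g^{n-b}`, `h^j g^{n-jb}` and the
  -- remainder.
  obtain ⟨j, hj⟩ : ∃ j, j = (n - 1) / b := ⟨_, rfl⟩
  have hj1 : j * b ≤ n - 1 := by rw [hj]; exact Nat.div_mul_le_self _ _
  have hj2 : n - 1 < j * b + b := by
    rw [hj]; have := Nat.lt_div_mul_add (a := n - 1) (b := b) (by omega); exact this
  have hjn : j < n - 1 := by
    rw [hj]; exact Nat.div_lt_self (by omega) (by omega)
  have hj0 : j ≠ 0 := by
    intro h0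
    rw [h0, zero_mul] at hj2
    omega
  have key : ∀ x y : ℕ, n ∣ x * b + y → (x • {h} + y • {g} : Multiset G).sum = 0 := by
    intro x y hxy
    rw [Multiset.sum_add, Multiset.sum_nsmul, Multiset.sum_nsmul, Multiset.sum_singleton,
      Multiset.sum_singleton, ← hb, ← mul_nsmul', ← add_nsmul,
      ← addOrderOf_dvd_iff_nsmul_eq_zero, hg]
    exact hxy
  have hle : n • {h} + n • {g} ≤ n • A := by
    rw [← nsmul_add]
    refine nsmul_le_nsmul_right ?_ n
    refine (Multiset.le_iff_subset ?_).2 ?_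
    · simp [Ne.symm hne]
    · intro a ha
      simp only [Multiset.singleton_add, Multiset.mem_cons, Multiset.mem_singleton] at ha
      rcases ha with rfl | rfl <;> assumption
  have hnA := sum_nsmul_eq_zero hA n
  have s0 : (n • {h} + n • {g} : Multiset G).sum = 0 :=
    key n n ((Dvd.intro b rfl).add dvd_rfl)
  have hU' := hU.of_le hnA hle s0
  have ah : IsAtom (n • ({h} : Multiset G)) := by
    simpa [hh] using isAtom_addOrderOf_nsmul (g := h) (by omega)
  have ag : IsAtom (n • ({g} : Multiset G)) := by
    simpa [hg] using isAtom_addOrderOf_nsmul (g := g) (by omega)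
  have hlen2 := hU'.len_eq (ah.isFactorization.add ag.isFactorization)
  have s1 := key 1 (n - b) ⟨1, by omega⟩
  have s2 := key j (n - j * b) ⟨1, by omega⟩
  have s3 := key (n - 1 - j) (b + j * b - n) ⟨b - 1, by
    zify [show 1 ≤ b by omega, show n ≤ b + j * b by omega, show j ≤ n - 1 by omega,
      show 1 ≤ n by omega]
    ring⟩
  have hdec : (n • {h} + n • {g} : Multiset G) = ((1 • {h} + (n - b) • {g}) +
      (j • {h} + (n - j * b) • {g})) + ((n - 1 - j) • {h} + (b + j * b - n) • {g}) := by
    have e1 : n = 1 + j + (n - 1 - j) := by omega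
    have e2 : n = (n - b) + (n - j * b) + (b + j * b - n) := by omega
    have e3 : n • ({h} : Multiset G) = (1 + j + (n - 1 - j)) • {h} := congrArg (· • _) e1
    have e4 : n • ({g} : Multiset G) = ((n - b) + (n - j * b) + (b + j * b - n)) • {g} :=
      congrArg (· • _) e2
    rw [e3, e4]
    simp only [add_nsmul]
    abel
  have s12 : ((1 • {h} + (n - b) • {g}) + (j • {h} + (n - j * b) • {g}) : Multiset G).sum = 0 := by
    rw [Multiset.sum_add, s1, s2, add_zero]
  have hpos : ∀ x y : ℕ, x ≠ 0 → (x • {h} + y • {g} : Multiset G) ≠ 0 := by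
    intro x y hx h0
    have := congrArg Multiset.card h0
    simp at this
    omega
  rw [hdec] at hU' hlen2 s0
  have hle12 := Multiset.le_add_right ((1 • {h} + (n - b) • {g}) + (j • {h} + (n - j * b) • {g}))
    ((n - 1 - j) • {h} + (b + j * b - n) • {g})
  rw [hU'.len_add s0 le_rfl s12 s3, hU'.len_add s0 hle12 s1 s2] at hlen2
  have l1 := (hU'.of_le s0 ((Multiset.le_add_right _ _).trans hle12) s1).one_le_len s1
    (hpos _ _ one_ne_zero)
  have l2 := (hU'.of_le s0 ((Multiset.le_add_left _ _).trans hle12) s2).one_le_len s2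
    (hpos _ _ hj0)
  have l3 := (hU'.of_le s0 (Multiset.le_add_left _ _) s3).one_le_len s3 (hpos _ _ (by omega))
  simp only [Multiset.card_add, Multiset.card_singleton] at hlen2
  omega

/-- The bound for cyclic groups. -/
theorem uniqueLength_of_isAddCyclic [IsAddCyclic G] (hn : 0 < n) (hexp : ∀ g : G, n • g = 0)
    (hA : A.sum = 0) (hU : UniqueLength (n • A)) {B : Multiset G} (hBA : B ⊆ A) :
    UniqueLength B := by
  refine uniqueLength_of_crossNumber_eq_one
    (fun U => crossNumber_eq_one hn hexp hA hU le_rfl ?_) hBA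
  intro U hat hUA hk
  obtain ⟨i, hi, hlt, hge, hlin⟩ := exists_minimal_multiple hn hexp hA hU le_rfl hat hUA hk
  refine ⟨i + 1, ?_, hge⟩
  have hd := fun g => addOrderOf_dvd_of_nsmul_eq_zero (hexp g)
  have hiU := sum_nsmul_eq_zero hat.2.1 i
  have hiA := nsmul_subset_of_subset hUA i
  suffices h : reducedDefect (i • U + U) = reducedDefect (i • U) + reducedDefect U by
    rw [succ_nsmul, h, hlin]
    push_cast; ring
  by_cases hgood : ∀ g ∈ A,
      (i • U).count g % addOrderOf g + U.count g % addOrderOf g ≤ n * A.count g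
  · exact reducedDefect_add hn hexp hA hU hiU hat.2.1 hiA hUA hgood
  push Not at hgood
  obtain ⟨h, hh, hbad⟩ := hgood
  have hbad' : n < (i • U).count h % addOrderOf h + U.count h % addOrderOf h := by
    by_contra! hle
    exact absurd (le_mul_count hh hle) (by omega)
  have hoh : addOrderOf h = n := by
    by_contra hne
    have := mod_add_mod_le_of_dvd_of_ne (hd h) hn hne ((i • U).count h) (U.count h)
    omega
  -- The residues at `h` exceed `n` in total, so those of the negatives add up to less than `n`;
  -- additivity is proved for the negatives.
  have key := reducedDefect_add hn hexp hA hU (B := (n - 1) • (i • U)) (C := (n - 1) • U)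
    (sum_nsmul_eq_zero hiU _) (sum_nsmul_eq_zero hat.2.1 _) (nsmul_subset_of_subset hiA _)
    (nsmul_subset_of_subset hUA _) ?_
  · rw [← nsmul_add, reducedDefect_pred_nsmul hn hexp hA hU le_rfl hat.2.1 hUA,
      reducedDefect_pred_nsmul hn hexp hA hU le_rfl hiU hiA,
      reducedDefect_pred_nsmul hn hexp hA hU le_rfl
        (by rw [Multiset.sum_add, hiU, hat.2.1, add_zero])
        (by rw [← succ_nsmul]; exact nsmul_subset_of_subset hUA _)] at key
    linarith
  · intro g hg
    refine le_mul_count hg ?_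
    by_cases hog : addOrderOf g = n
    · have hz := mem_zmultiples_of_addOrderOf_eq hn hexp hog h
      obtain rfl := addOrderOf_ne_of_zmultiples hn hA hU hg hh hog hoh hz
      have h1 := mod_add_pred_mul_mod_le (hd g) hn ((i • U).count g)
      have h2 := mod_add_pred_mul_mod_le (hd g) hn (U.count g)
      rw [Multiset.count_nsmul, Multiset.count_nsmul _ (n - 1)]
      rw [hog] at *
      omega
    · exact mod_add_mod_le_of_dvd_of_ne (hd g) hn hog _ _

end UpperBound

lemma nsmul_pair {α : Type*} (m : ℕ) (a b : α) : m • ({a, b} : Multiset α) = m • {a} + m • {b} := by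
  rw [← nsmul_add, Multiset.singleton_add]
  rfl

/-! ### Lower bounds -/

section LowerBound

variable {G : Type*} [AddCommGroup G]

/-- If `A ^ N` has a unique factorization length, then the sequences over the support of `A`
have unique factorization lengths. -/
def PowerDetectsUniqueLength (G : Type*) [AddCommGroup G] (N : ℕ) : Prop :=
  ∀ A : Multiset G, A.sum = 0 → UniqueLength (N • A) →
    ∀ B : Multiset G, B ⊆ A → B.sum = 0 → UniqueLength B

lemma uniqueLength_of_card_eq {k : ℕ} (hk : 0 < k) {B : Multiset G}
    (h : ∀ U, IsAtom U → U ≤ B → U.card = k) : UniqueLength B := by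
  have key : ∀ F, IsFactorization F B → F.card * k = B.card := by
    intro F hF
    rw [← hF.2, ← Multiset.join, Multiset.card_join,
      Multiset.map_congr rfl (g := fun _ => k) fun U hU => h U (hF.1 U hU) (hF.le hU)]
    simp
  intro F F' hF hF'
  exact Nat.eq_of_mul_eq_mul_right hk ((key F hF).trans (key F' hF').symm)

lemma exists_add_of_le_add {α : Type*} {U X Y : Multiset α} (h : U ≤ X + Y) :
    ∃ V ≤ X, ∃ W ≤ Y, U = V + W := by
  classical
  refine ⟨U ∩ X, Multiset.inter_le_right, U - X, ?_, ?_⟩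
  · rwa [tsub_le_iff_left]
  · rw [add_comm, Multiset.sub_add_inter]

lemma IsAtom.eq_of_add {V W : Multiset G} (h : IsAtom (V + W)) (hV : V.sum = 0) (hV0 : V ≠ 0) :
    W = 0 := by
  have hW : W.sum = 0 := by
    have := h.2.1
    rwa [Multiset.sum_add, hV, zero_add] at this
  exact (h.2.2 V W hV hW rfl).resolve_left hV0

lemma sum_pair_neg (g : G) : ({g, -g} : Multiset G).sum = 0 := by simp

lemma isAtom_pair_neg {g : G} (hg : g ≠ 0) : IsAtom ({g, -g} : Multiset G) := by
  refine isAtom_of_card_le_three (sum_pair_neg g) (by simp) ?_ (by simp)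
  simp [hg, Ne.symm hg]

lemma uniqueLength_nsmul_pair_neg {N : ℕ} {g : G} (h : N < addOrderOf g) :
    UniqueLength (N • ({g, -g} : Multiset G)) := by
  refine uniqueLength_of_card_eq two_pos fun U hat hU => ?_
  rw [nsmul_pair] at hU
  obtain ⟨V, hV, W, hW, rfl⟩ := exists_add_of_le_add hU
  obtain ⟨c, hc, rfl⟩ := le_nsmul_singleton hV
  obtain ⟨d, hd, rfl⟩ := le_nsmul_singleton hW
  have hs := hat.2.1
  rw [Multiset.sum_add, Multiset.sum_nsmul, Multiset.sum_nsmul, Multiset.sum_singleton,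
    Multiset.sum_singleton, smul_neg, add_neg_eq_zero] at hs
  -- Both multiplicities are at most `N`, below the order of `g`, so the only atom is the pair `g,
  -- -g`.
  obtain rfl : c = d := nsmul_injOn_Iio_addOrderOf (hc.trans_lt h) (hd.trans_lt h) hs
  rw [← nsmul_pair] at hat ⊢
  cases c with
  | zero => exact absurd (zero_nsmul _) hat.1
  | succ c =>
    rw [succ_nsmul'] at hat ⊢
    rw [hat.eq_of_add (sum_pair_neg g) (by simp)]
    simp

lemma not_uniqueLength_nsmul_pair_neg {g : G} (h : 3 ≤ addOrderOf g) :
    ¬ UniqueLength (addOrderOf g • ({g, -g} : Multiset G)) := by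
  intro hu
  have hg : g ≠ 0 := by rintro rfl; simp at h
  have a1 := isAtom_addOrderOf_nsmul (g := g) (by omega)
  have a2 := isAtom_addOrderOf_nsmul (g := -g) (by rw [addOrderOf_neg]; omega)
  rw [addOrderOf_neg] at a2
  have f1 := a1.isFactorization.add a2.isFactorization
  rw [← nsmul_pair] at f1
  have := hu _ _ f1 ((isAtom_pair_neg hg).isFactorization.nsmul _)
  simp at this
  omega

theorem PowerDetectsUniqueLength.addOrderOf_le {N : ℕ} (hN : PowerDetectsUniqueLength G N) {g : G}
    (h : 3 ≤ addOrderOf g) : addOrderOf g ≤ N := by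
  by_contra! hlt
  exact not_uniqueLength_nsmul_pair_neg h (hN _ (sum_pair_neg g) (uniqueLength_nsmul_pair_neg hlt)
    _ (fun _ => Multiset.mem_of_mem_nsmul) (sum_nsmul_eq_zero (sum_pair_neg g) _))

lemma isAtom_nsmul_add_singleton_neg {g : G} (hg : addOrderOf g = 0) (m : ℕ) :
    IsAtom (m • {g} + {-(m • g)} : Multiset G) := by
  have key : ∀ V W : Multiset G, W.sum = 0 → V + W = m • {g} + {-(m • g)} →
      -(m • g) ∈ V → W = 0 := by
    intro V W hW hVW hmem
    obtain ⟨V', rfl⟩ := Multiset.exists_cons_of_mem hmem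
    rw [← Multiset.singleton_add, add_assoc,
      add_comm (m • {g} : Multiset G), add_right_inj, add_comm V'] at hVW
    obtain ⟨c, -, rfl⟩ := le_nsmul_singleton (hVW ▸ Multiset.le_add_right W V')
    rw [Multiset.sum_nsmul, Multiset.sum_singleton, ← addOrderOf_dvd_iff_nsmul_eq_zero, hg,
      zero_dvd_iff] at hW
    rw [hW, zero_nsmul]
  refine ⟨?_, by simp [Multiset.sum_nsmul], fun V W hV hW hVW => ?_⟩
  · intro h0
    have := congrArg Multiset.card h0
    simp at this
  · have hmem : -(m • g) ∈ V + W := by rw [hVW]; simp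
    rcases Multiset.mem_add.1 hmem with h | h
    · exact Or.inr (key V W hW hVW h)
    · exact Or.inl (key W V hV (by rw [add_comm, hVW]) h)

theorem PowerDetectsUniqueLength.addOrderOf_pos {N : ℕ} (hN0 : 0 < N)
    (hN : PowerDetectsUniqueLength G N) (g : G) : 0 < addOrderOf g := by
  rw [Nat.pos_iff_ne_zero]
  intro hg
  -- With `m > N`, multiplicities up to `N` of `g` and `-g` cannot be traded for `mg`, so every atom
  -- is a pair. With multiplicity `m` they can, which gives the lengths `m + 1` and 2.
  obtain ⟨m, hm⟩ : ∃ m, m = N + 1 := ⟨_, rfl⟩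
  have hzs : ∀ z : ℤ, z • g = 0 → z = 0 := by
    intro z hz
    rwa [← addOrderOf_dvd_iff_zsmul_eq_zero, hg, Nat.cast_zero, zero_dvd_iff] at hz
  have hg0 : g ≠ 0 := by rintro rfl; simp at hg
  have hmg0 : m • g ≠ 0 := by
    intro h
    have := hzs m (by rwa [natCast_zsmul])
    omega
  have hA : ({g, -g} + {m • g, -(m • g)} : Multiset G).sum = 0 := by simp
  have hu : UniqueLength (N • ({g, -g} + {m • g, -(m • g)} : Multiset G)) := by
    refine uniqueLength_of_card_eq two_pos fun U hat hU => ?_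
    rw [nsmul_add, nsmul_pair, nsmul_pair] at hU
    obtain ⟨V, hV, W, hW, rfl⟩ := exists_add_of_le_add hU
    obtain ⟨V₁, hV₁, V₂, hV₂, rfl⟩ := exists_add_of_le_add hV
    obtain ⟨W₁, hW₁, W₂, hW₂, rfl⟩ := exists_add_of_le_add hW
    obtain ⟨a, ha, rfl⟩ := le_nsmul_singleton hV₁
    obtain ⟨b, hb, rfl⟩ := le_nsmul_singleton hV₂
    obtain ⟨c, hc, rfl⟩ := le_nsmul_singleton hW₁
    obtain ⟨d, hd, rfl⟩ := le_nsmul_singleton hW₂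
    have hs := hat.2.1
    simp only [Multiset.sum_add, Multiset.sum_nsmul, Multiset.sum_singleton] at hs
    have hz : (a : ℤ) - b + m * (c - d) = 0 := by
      apply hzs
      rw [← hs]
      simp only [add_smul, sub_smul, mul_smul, natCast_zsmul, smul_neg, smul_sub]
      rw [nsmul_left_comm g m c, nsmul_left_comm g m d]
      abel
    have hab : (a : ℤ) - b = 0 := by
      apply Int.eq_zero_of_abs_lt_dvd (m := m)
      · exact ⟨d - c, by linarith⟩
      · rw [abs_lt]; constructor <;> omega
    have hcd : (c : ℤ) - d = 0 := by
      rw [hab, zero_add, mul_eq_zero] at hz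
      omega
    obtain rfl : a = b := by omega
    obtain rfl : c = d := by omega
    rw [← nsmul_pair, ← nsmul_pair] at hat ⊢
    cases a with
    | succ a =>
      rw [succ_nsmul', add_assoc] at hat ⊢
      rw [hat.eq_of_add (sum_pair_neg g) (by simp)]
      simp
    | zero =>
      cases c with
      | zero => simp [IsAtom] at hat
      | succ c =>
        rw [succ_nsmul', zero_nsmul, zero_add] at hat ⊢
        rw [hat.eq_of_add (sum_pair_neg _) (by simp)]
        simp
  have hB := hN _ hA hu (m • {g, -g} + {m • g, -(m • g)}) (by
    intro x hx
    rcases Multiset.mem_add.1 hx with hx | hx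
    · exact Multiset.mem_add.2 (Or.inl (Multiset.mem_of_mem_nsmul hx))
    · exact Multiset.mem_add.2 (Or.inr hx)) (by
    rw [Multiset.sum_add, sum_nsmul_eq_zero (sum_pair_neg g), sum_pair_neg, add_zero])
  have f1 := ((isAtom_pair_neg hg0).isFactorization.nsmul m).add
    (isAtom_pair_neg hmg0).isFactorization
  have f2 := (isAtom_nsmul_add_singleton_neg hg m).isFactorization.add
    (isAtom_nsmul_add_singleton_neg (g := -g) (by rwa [addOrderOf_neg]) m).isFactorization
  have he : (m • {g} + {-(m • g)} + (m • {-g} + {-(m • -g)}) : Multiset G) =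
      m • {g, -g} + {m • g, -(m • g)} := by
    rw [nsmul_pair, smul_neg, neg_neg]
    have : ({m • g, -(m • g)} : Multiset G) = {m • g} + {-(m • g)} := rfl
    rw [this]
    abel
  rw [he] at f2
  have := hB _ _ f1 f2
  simp at this
  omega

lemma isAtom_two_nsmul_singleton {g : G} (hg : g ≠ 0) (h : 2 • g = 0) :
    IsAtom (2 • ({g} : Multiset G)) := by
  have ho : addOrderOf g = 2 := addOrderOf_eq_prime h hg
  simpa [ho] using isAtom_addOrderOf_nsmul (g := g) (by omega)

/-- The sequence `a b (a+b)` is an atom, but its square is also the product of the three atoms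
`a^2`, `b^2` and `(a+b)^2`. -/
theorem not_powerDetectsUniqueLength_one (hexp : ∀ g : G, 2 • g = 0) {a b : G} (ha : a ≠ 0)
    (hb : b ≠ 0) (hab : a ≠ b) : ¬ PowerDetectsUniqueLength G 1 := by
  intro hN
  have hsum0 : a + b ≠ 0 := by
    intro h
    apply hab
    have h2 : a = -b := eq_neg_of_add_eq_zero_left h
    have h3 : b + b = 0 := by rw [← two_nsmul, hexp]
    rw [h2, neg_eq_iff_add_eq_zero, h3]
  have hs : ({a, b, a + b} : Multiset G).sum = 0 := by
    have : ({a, b, a + b} : Multiset G).sum = 2 • (a + b) := by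
      simp only [Multiset.insert_eq_cons, Multiset.sum_cons, Multiset.sum_singleton]
      abel
    rw [this, hexp]
  have hat : IsAtom ({a, b, a + b} : Multiset G) := by
    refine isAtom_of_card_le_three hs (by simp) ?_ (by simp)
    simp [ha.symm, hb.symm, hsum0.symm]
  have hu := hN _ hs (by rw [one_nsmul]; exact hat.uniqueLength) (2 • {a, b, a + b})
    (fun _ => Multiset.mem_of_mem_nsmul) (sum_nsmul_eq_zero hs 2)
  have f2 := ((isAtom_two_nsmul_singleton ha (hexp a)).isFactorization.add
    (isAtom_two_nsmul_singleton hb (hexp b)).isFactorization).add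
    (isAtom_two_nsmul_singleton hsum0 (hexp _)).isFactorization
  rw [← nsmul_add, ← nsmul_add] at f2
  have := hu _ _ (hat.isFactorization.nsmul 2) f2
  simp at this

end LowerBound

/-! ### Transfer of lengths between `H` and `𝓑(G)` -/

section Transfer

variable {H G : Type*} [Monoid H] [AddCommGroup G]

/-- The underlying sequence of an element of `𝓑(G)`. -/
def seq (t : ZeroSumMonoid G) : Multiset G := (Multiplicative.toAdd t).1

/-- A zero-sum sequence as an element of `𝓑(G)`. -/
def ofSeq (B : Multiset G) (hB : B.sum = 0) : ZeroSumMonoid G := Multiplicative.ofAdd ⟨B, hB⟩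

lemma seq_ofSeq (B : Multiset G) (hB : B.sum = 0) : seq (ofSeq B hB) = B := rfl

lemma sum_seq (t : ZeroSumMonoid G) : (seq t).sum = 0 := (Multiplicative.toAdd t).2

lemma seq_mul (s t : ZeroSumMonoid G) : seq (s * t) = seq s + seq t := rfl

lemma seq_one : seq (1 : ZeroSumMonoid G) = 0 := rfl

lemma seq_pow (t : ZeroSumMonoid G) (m : ℕ) : seq (t ^ m) = m • seq t := by
  induction m with
  | zero => simp [seq_one]
  | succ m ih => rw [pow_succ, seq_mul, ih, succ_nsmul]

lemma seq_injective : Function.Injective (seq : ZeroSumMonoid G → Multiset G) :=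
  fun _ _ h => Multiplicative.toAdd.injective (Subtype.ext h)

lemma seq_eq_zero {t : ZeroSumMonoid G} : seq t = 0 ↔ t = 1 :=
  ⟨fun h => seq_injective h, fun h => h ▸ seq_one⟩

lemma seq_prod (l : List (ZeroSumMonoid G)) :
    seq l.prod = ((l.map seq : List _) : Multiset _).sum := by
  induction l with
  | nil => simp [seq_one]
  | cons t l ih =>
    rw [List.prod_cons, seq_mul, ih]
    simp

lemma isUnit_iff_eq_one {t : ZeroSumMonoid G} : IsUnit t ↔ t = 1 := by
  refine ⟨?_, fun h => h ▸ isUnit_one⟩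
  rintro ⟨u, rfl⟩
  have h : seq (u : ZeroSumMonoid G) + seq (↑u⁻¹ : ZeroSumMonoid G) = 0 := by
    rw [← seq_mul, Units.mul_inv, seq_one]
  rw [← seq_eq_zero]
  exact (add_eq_zero.1 h).1

lemma units_eq_one (u : (ZeroSumMonoid G)ˣ) : (u : ZeroSumMonoid G) = 1 :=
  isUnit_iff_eq_one.1 u.isUnit

lemma irreducible_iff_isAtom {t : ZeroSumMonoid G} : Irreducible t ↔ IsAtom (seq t) := by
  rw [irreducible_iff, isUnit_iff_eq_one, ← seq_eq_zero]
  refine ⟨fun h => ⟨h.1, sum_seq t, fun V W hV hW hVW => ?_⟩, fun h => ⟨h.1, fun {a b} hab => ?_⟩⟩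
  · obtain ⟨-, h2⟩ := h
    have := @h2 (ofSeq V hV) (ofSeq W hW) (seq_injective hVW.symm)
    rwa [isUnit_iff_eq_one, isUnit_iff_eq_one, ← seq_eq_zero, ← seq_eq_zero] at this
  · rw [isUnit_iff_eq_one, isUnit_iff_eq_one, ← seq_eq_zero, ← seq_eq_zero]
    exact h.2.2 _ _ (sum_seq a) (sum_seq b) (by rw [hab, seq_mul])

lemma exists_list_of_isFactorization {F : Multiset (Multiset G)} {t : ZeroSumMonoid G}
    (hF : IsFactorization F (seq t)) :
    ∃ l : List (ZeroSumMonoid G), (∀ v ∈ l, Irreducible v) ∧ l.prod = t ∧ l.length = F.card := by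
  obtain ⟨l, rfl⟩ : ∃ l : List (ZeroSumMonoid G), ((l.map seq : List _) : Multiset _) = F := by
    have hat := hF.1
    clear hF
    induction F using Multiset.induction_on with
    | empty => exact ⟨[], rfl⟩
    | cons U F ih =>
      obtain ⟨l, rfl⟩ := ih fun V hV => hat V (Multiset.mem_cons_of_mem hV)
      exact ⟨ofSeq U (hat U (Multiset.mem_cons_self _ _)).2.1 :: l, by simp [seq_ofSeq]⟩
  refine ⟨l, fun v hv => irreducible_iff_isAtom.2 (hF.1 _ ?_), ?_, by simp⟩
  · exact Multiset.mem_coe.2 (List.mem_map_of_mem hv)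
  · exact seq_injective (by rw [seq_prod, hF.2])

variable {θ : H →* ZeroSumMonoid G}

/-- Lifting of factorizations along a weak transfer homomorphism to `𝓑(G)`, in the given order. -/
lemma exists_lift (hθ : IsWeakTransferHom θ) {a : H} (ha : ¬ IsUnit a)
    {l : List (ZeroSumMonoid G)} (hl : ∀ v ∈ l, Irreducible v) (hprod : l.prod = θ a) :
    ∃ m m' : List H, (∀ u ∈ m, Irreducible u) ∧ m.prod = a ∧ m'.Perm m ∧ m'.map θ = l := by
  have hne : l ≠ [] := by
    rintro rfl
    exact ha ((hθ.isUnit_iff a).1 (by rw [← hprod]; simp))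
  obtain ⟨m, l', hm, ha', hperm, hf⟩ := hθ.lift a l hne hl hprod.symm
  have hmap : m.map θ = l' := by
    clear hm ha' hperm
    induction hf with
    | nil => rfl
    | cons h _ ih =>
      obtain ⟨ε, η, h⟩ := h
      rw [List.map_cons, ih, h, units_eq_one, units_eq_one, one_mul, mul_one]
  subst hmap
  obtain ⟨m', he, hm'⟩ : Relation.Comp (· = List.map θ ·) List.Perm l m := by
    rw [List.eq_map_comp_perm]
    exact hperm.symm
  exact ⟨m, m', hm, ha'.symm, hm', he.symm⟩

lemma isUnit_iff_seq_eq_zero (hθ : IsWeakTransferHom θ) {a : H} : IsUnit a ↔ seq (θ a) = 0 := by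
  rw [← hθ.isUnit_iff, isUnit_iff_eq_one, seq_eq_zero]

/-- A factorization of `θ u` lifts to one of `u` with the same number of atoms, and that number is
1. -/
lemma isAtom_of_irreducible (hθ : IsWeakTransferHom θ) {u : H} (hu : Irreducible u) :
    IsAtom (seq (θ u)) := by
  obtain ⟨F, hF⟩ := exists_isFactorization _ (sum_seq (θ u))
  obtain ⟨l, hl, hprod, -⟩ := exists_list_of_isFactorization hF
  obtain ⟨m, m', hm, hmu, hperm, hmap⟩ := exists_lift hθ hu.not_isUnit hl hprod
  match m, hm, hmu, hperm with
  | [], _, hmu, _ => exact absurd (by rw [← hmu]; simp) hu.not_isUnit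
  | [x], _, hmu, hperm =>
    rw [List.perm_singleton] at hperm
    subst hperm
    rw [List.prod_singleton] at hmu
    subst hmu
    rw [← irreducible_iff_isAtom]
    exact hl _ (by rw [← hmap]; simp)
  | x :: y :: m, hm, hmu, _ =>
    rw [List.prod_cons] at hmu
    rcases hu.isUnit_or_isUnit hmu.symm with h | h
    · exact absurd h (hm x (by simp)).not_isUnit
    · have h0 : seq (θ (y :: m).prod) = 0 := (isUnit_iff_seq_eq_zero hθ).1 h
      rw [List.prod_cons, map_mul, seq_mul, add_eq_zero] at h0
      exact absurd ((isUnit_iff_seq_eq_zero hθ).2 h0.1) (hm y (by simp)).not_isUnit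

lemma mem_lengthSet_iff (hθ : IsWeakTransferHom θ) {a : H} {k : ℕ} :
    k ∈ lengthSet a ↔ ∃ F, IsFactorization F (seq (θ a)) ∧ F.card = k := by
  by_cases ha : IsUnit a
  · have h0 := (isUnit_iff_seq_eq_zero hθ).1 ha
    rw [h0]
    constructor
    · rintro (⟨-, rfl⟩ | ⟨h, -⟩)
      · exact ⟨0, ⟨by simp, by simp⟩, by simp⟩
      · exact absurd ha h
    · rintro ⟨F, hF, rfl⟩
      exact Or.inl ⟨ha, by rw [hF.eq_zero]; rfl⟩
  · constructor
    · rintro (⟨h, -⟩ | ⟨-, l, hl, rfl, rfl⟩)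
      · exact absurd h ha
      · refine ⟨((l.map fun u => seq (θ u) : List _) : Multiset _), ⟨?_, ?_⟩, by simp⟩
        · intro U hU
          simp only [Multiset.mem_coe, List.mem_map] at hU
          obtain ⟨u, hu, rfl⟩ := hU
          exact isAtom_of_irreducible hθ (hl u hu)
        · rw [map_list_prod, seq_prod, List.map_map]
          rfl
    · rintro ⟨F, hF, rfl⟩
      obtain ⟨l, hl, hprod, hlen⟩ := exists_list_of_isFactorization hF
      obtain ⟨m, m', hm, hma, hperm, hmap⟩ := exists_lift hθ ha hl hprod
      exact Or.inr ⟨ha, m, hm, hma, by rw [← hlen, ← hmap, List.length_map, hperm.length_eq]⟩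

lemma encard_lengthSet_eq_one_iff (hθ : IsWeakTransferHom θ) {a : H} :
    (lengthSet a).encard = 1 ↔ UniqueLength (seq (θ a)) := by
  rw [Set.encard_eq_one]
  constructor
  · rintro ⟨k, hk⟩ F F' hF hF'
    have h1 : F.card ∈ lengthSet a := (mem_lengthSet_iff hθ).2 ⟨F, hF, rfl⟩
    have h2 : F'.card ∈ lengthSet a := (mem_lengthSet_iff hθ).2 ⟨F', hF', rfl⟩
    rw [hk, Set.mem_singleton_iff] at h1 h2
    rw [h1, h2]
  · intro hu
    obtain ⟨F, hF⟩ := exists_isFactorization _ (sum_seq (θ a))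
    refine ⟨F.card, Set.eq_singleton_iff_unique_mem.2 ⟨(mem_lengthSet_iff hθ).2 ⟨F, hF, rfl⟩, ?_⟩⟩
    intro k hk
    obtain ⟨F', hF', rfl⟩ := (mem_lengthSet_iff hθ).1 hk
    exact hu _ _ hF' hF

end Transfer

/-! ### Divisor-closed submonoids -/

section DivisorClosed

variable {H : Type*} [Monoid H] {S : Submonoid H}

lemma isDivisorClosed_divisorClosure (a : H) : IsDivisorClosed (divisorClosure a) := by
  intro x b y h
  rw [divisorClosure, Submonoid.mem_sInf] at h ⊢
  exact fun S hS => hS.1 x b y (h S hS)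

lemma mem_divisorClosure (a : H) : a ∈ divisorClosure a := by
  rw [divisorClosure, Submonoid.mem_sInf]
  exact fun S hS => hS.2

lemma divisorClosure_le {a : H} (hS : IsDivisorClosed S) (ha : a ∈ S) : divisorClosure a ≤ S :=
  sInf_le ⟨hS, ha⟩

lemma isUnit_coe_iff (hS : IsDivisorClosed S) {a : S} : IsUnit (a : H) ↔ IsUnit a := by
  refine ⟨?_, fun h => h.map S.subtype⟩
  rintro ⟨u, hu⟩
  have hinv : (↑u⁻¹ : H) ∈ S := hS (u : H) _ 1 (by simp)
  exact ⟨⟨a, ⟨_, hinv⟩, Subtype.ext (by simp [← hu]), Subtype.ext (by simp [← hu])⟩, rfl⟩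

lemma irreducible_coe_iff (hS : IsDivisorClosed S) {a : S} :
    Irreducible (a : H) ↔ Irreducible a := by
  rw [irreducible_iff, irreducible_iff, isUnit_coe_iff hS]
  refine and_congr_right fun _ => ⟨fun h x y hxy => ?_, fun h x y hxy => ?_⟩
  · have := h (a := x) (b := y) (by rw [hxy]; rfl)
    rwa [isUnit_coe_iff hS, isUnit_coe_iff hS] at this
  · have hx : x ∈ S := hS 1 x y (by rw [one_mul, ← hxy]; exact a.2)
    have hy : y ∈ S := hS x y 1 (by rw [mul_one, ← hxy]; exact a.2)
    have := h (a := ⟨x, hx⟩) (b := ⟨y, hy⟩) (Subtype.ext hxy)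
    rwa [← isUnit_coe_iff hS, ← isUnit_coe_iff hS] at this

lemma lengthSet_coe (hS : IsDivisorClosed S) (a : S) : lengthSet (a : H) = lengthSet a := by
  ext k
  simp only [lengthSet, Set.mem_ofPred_eq, isUnit_coe_iff hS]
  refine or_congr Iff.rfl (and_congr_right fun _ => ⟨?_, ?_⟩)
  · rintro ⟨l, hl, hprod, rfl⟩
    have hmem : ∀ u ∈ l, u ∈ S := by
      intro u hu
      obtain ⟨s, t, rfl⟩ := List.append_of_mem hu
      refine hS s.prod u t.prod ?_
      rw [mul_assoc, ← List.prod_cons, ← List.prod_append, hprod]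
      exact a.2
    obtain ⟨l, rfl⟩ : ∃ l' : List S, l'.map S.subtype = l :=
      ⟨l.attach.map fun u => ⟨u.1, hmem u.1 u.2⟩, by simp [List.map_map, Function.comp_def]⟩
    refine ⟨l, fun u hu => ?_, ?_, by simp⟩
    · exact (irreducible_coe_iff hS).1 (hl _ (List.mem_map_of_mem hu))
    · rw [← map_list_prod] at hprod
      exact Subtype.ext hprod
  · rintro ⟨l, hl, rfl, rfl⟩
    refine ⟨l.map S.subtype, ?_, by rw [← map_list_prod]; rfl, by simp⟩
    intro u hu
    obtain ⟨v, hv, rfl⟩ := List.mem_map.1 hu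
    exact (irreducible_coe_iff hS).2 (hl v hv)

end DivisorClosed

/-! ### Divisor closures under the transfer homomorphism -/

section Transfer

variable {H G : Type*} [Monoid H] [AddCommGroup G] {θ : H →* ZeroSumMonoid G}

lemma seq_subset_of_mem_divisorClosure {a b : H} (hb : b ∈ divisorClosure a) :
    seq (θ b) ⊆ seq (θ a) := by
  let S : Submonoid H :=
    { carrier := {b | seq (θ b) ⊆ seq (θ a)}
      one_mem' := by simp [seq_one]
      mul_mem' := by
        intro x y hx hy g hg
        rw [map_mul, seq_mul, Multiset.mem_add] at hg
        exact hg.elim (fun h => hx h) fun h => hy h }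
  refine divisorClosure_le (S := S) ?_ (Multiset.Subset.refl _) hb
  intro x b y h g hg
  refine h ?_
  rw [map_mul, map_mul, seq_mul, seq_mul]
  simp [hg]

lemma exists_mem_divisorClosure (hθ : IsWeakTransferHom θ) {a : H} {B : Multiset G}
    (hB : B.sum = 0) (hBA : B ⊆ seq (θ a)) : ∃ b ∈ divisorClosure a, seq (θ b) = B := by
  by_cases hB0 : B = 0
  · exact ⟨1, one_mem _, by rw [map_one, seq_one, hB0]⟩
  obtain ⟨k, hk⟩ := exists_le_nsmul hBA
  rw [← seq_pow, ← map_pow] at hk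
  obtain ⟨C, hBC, hC⟩ := sum_tsub hk hB (sum_seq _)
  have hau : ¬ IsUnit (a ^ k) := by
    rw [isUnit_iff_seq_eq_zero hθ, hBC, add_eq_zero]
    exact fun h => hB0 h.1
  obtain ⟨F, hF⟩ := exists_isFactorization B hB
  obtain ⟨E, hE⟩ := exists_isFactorization C hC
  obtain ⟨l₁, hl₁, hp₁, -⟩ := exists_list_of_isFactorization (t := ofSeq B hB) hF
  obtain ⟨l₂, hl₂, hp₂, -⟩ := exists_list_of_isFactorization (t := ofSeq C hC) hE
  obtain ⟨m, m', -, hma, hperm, hmap⟩ := exists_lift hθ hau (l := l₁ ++ l₂)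
    (fun v hv => (List.mem_append.1 hv).elim (hl₁ v) (hl₂ v))
    (by rw [List.prod_append, hp₁, hp₂]; exact seq_injective hBC.symm)
  obtain ⟨m₁, m₂, rfl, hm₁, -⟩ := List.map_eq_append_iff.1 hmap
  refine ⟨m₁.prod, ?_, by rw [map_list_prod, hm₁, hp₁, seq_ofSeq]⟩
  -- The lifted atoms may be permuted, so their product need not divide `a ^ k`; but each of them
  -- does, and the closure is a submonoid.
  refine Submonoid.list_prod_mem _ fun u hu => ?_
  obtain ⟨s, t, rfl⟩ := List.append_of_mem (hperm.subset (List.mem_append_left m₂ hu))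
  refine isDivisorClosed_divisorClosure a s.prod u t.prod ?_
  rw [mul_assoc, ← List.prod_cons, ← List.prod_append, hma]
  exact pow_mem (mem_divisorClosure a) k

lemma isHalfFactorial_divisorClosure_iff (hθ : IsWeakTransferHom θ) {a : H} :
    IsHalfFactorial (divisorClosure a) ↔
      ∀ B : Multiset G, B ⊆ seq (θ a) → B.sum = 0 → UniqueLength B := by
  constructor
  · intro h B hBA hB
    obtain ⟨b, hb, rfl⟩ := exists_mem_divisorClosure hθ hB hBA
    rw [← encard_lengthSet_eq_one_iff hθ]
    have := h ⟨b, hb⟩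
    rwa [← lengthSet_coe (isDivisorClosed_divisorClosure a)] at this
  · intro h b
    rw [← lengthSet_coe (isDivisorClosed_divisorClosure a), encard_lengthSet_eq_one_iff hθ]
    exact h _ (seq_subset_of_mem_divisorClosure b.2) (sum_seq _)

lemma forall_isHalfFactorial_iff (hθ : IsWeakTransferHom θ) (N : ℕ) :
    (∀ a : H, (lengthSet (a ^ N)).encard = 1 → IsHalfFactorial (divisorClosure a)) ↔
      PowerDetectsUniqueLength G N := by
  constructor
  · intro h A hA hu
    obtain ⟨a, ε, η, ha⟩ := hθ.surj (ofSeq A hA)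
    rw [units_eq_one, units_eq_one, one_mul, mul_one] at ha
    have haA : seq (θ a) = A := by rw [← ha, seq_ofSeq]
    subst haA
    rw [← isHalfFactorial_divisorClosure_iff hθ]
    refine h a ?_
    rwa [encard_lengthSet_eq_one_iff hθ, map_pow, seq_pow]
  · intro h a ha
    rw [encard_lengthSet_eq_one_iff hθ, map_pow, seq_pow] at ha
    exact (isHalfFactorial_divisorClosure_iff hθ).2 (h _ (sum_seq _) ha)

lemma hfIndex_eq (hθ : IsWeakTransferHom θ) :
    hfIndex H = sInf {M : ℕ∞ | ∃ N : ℕ, 0 < N ∧ M = N ∧ PowerDetectsUniqueLength G N} := by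
  simp only [hfIndex, forall_isHalfFactorial_iff hθ]

end Transfer

/-! ### Bounds for the index -/

section Index

variable {G : Type*} [AddCommGroup G] {n N : ℕ}

theorem powerDetectsUniqueLength_of_seven_le (hn : 7 ≤ n) (hexp : ∀ g : G, n • g = 0) :
    PowerDetectsUniqueLength G ((3 * n - 3) / 2) := by
  classical
  exact fun A hA hU B hBA _ => uniqueLength_of_seven_le hn hexp hA hU hBA

theorem powerDetectsUniqueLength_of_le_six (hn : 0 < n) (hn6 : n ≤ 6) (hexp : ∀ g : G, n • g = 0) :
    PowerDetectsUniqueLength G n := by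
  classical
  exact fun A hA hU B hBA _ => uniqueLength_of_le_six hn hn6 hexp hA hU hBA

theorem powerDetectsUniqueLength_of_isAddCyclic [IsAddCyclic G] (hn : 0 < n)
    (hexp : ∀ g : G, n • g = 0) : PowerDetectsUniqueLength G n := by
  classical
  exact fun A hA hU B hBA _ => uniqueLength_of_isAddCyclic hn hexp hA hU hBA

theorem PowerDetectsUniqueLength.exponentExists (hN0 : 0 < N) (hN : PowerDetectsUniqueLength G N) :
    AddMonoid.ExponentExists G := by
  -- Orders 1 and 2 are not bounded by `addOrderOf_le`; hence `N + 2`.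
  refine ⟨(N + 2).factorial, Nat.factorial_pos _, fun g => ?_⟩
  rw [← addOrderOf_dvd_iff_nsmul_eq_zero]
  refine Nat.dvd_factorial (hN.addOrderOf_pos hN0 g) ?_
  by_cases h : 3 ≤ addOrderOf g
  · have := hN.addOrderOf_le h
    omega
  · omega

lemma exists_ne_of_card_ne_two [Nontrivial G] (hG : ENat.card G ≠ 2) :
    ∃ a b : G, a ≠ 0 ∧ b ≠ 0 ∧ a ≠ b := by
  obtain ⟨a, ha⟩ := exists_ne (0 : G)
  by_contra! h
  have hcard : Nat.card G = 2 := by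
    rw [Nat.card_eq_two_iff]
    refine ⟨0, a, ha.symm, Set.eq_univ_of_forall fun b => ?_⟩
    by_cases hb : b = 0
    · exact Or.inl hb
    · exact Or.inr (h a b ha hb).symm
  have : Finite G := Nat.finite_of_card_ne_zero (by omega)
  rw [ENat.card_eq_coe_natCard, hcard] at hG
  exact hG rfl

theorem PowerDetectsUniqueLength.exponent_le (hN0 : 0 < N) (hN : PowerDetectsUniqueLength G N)
    (hG : ENat.card G ≠ 2) : AddMonoid.exponent G ≤ N := by
  obtain ⟨g, hg⟩ := AddMonoid.exists_addOrderOf_eq_exponent (hN.exponentExists hN0)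
  by_cases h3 : 3 ≤ AddMonoid.exponent G
  · rw [← hg] at h3 ⊢
    exact hN.addOrderOf_le h3
  · by_contra! hlt
    have h2 : AddMonoid.exponent G = 2 := by omega
    have h1 : N = 1 := by omega
    subst h1
    have hnt : Nontrivial G := by
      rw [← not_subsingleton_iff_nontrivial, ← AddMonoid.exp_eq_one_iff]
      omega
    obtain ⟨a, b, ha, hb, hab⟩ := exists_ne_of_card_ne_two hG
    refine not_powerDetectsUniqueLength_one (fun g => ?_) ha hb hab hN
    rw [← h2, AddMonoid.exponent_nsmul_eq_zero]

variable {H : Type*} [Monoid H] {θ : H →* ZeroSumMonoid G}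

lemma hfIndex_le (hθ : IsWeakTransferHom θ) (hN0 : 0 < N) (hN : PowerDetectsUniqueLength G N) :
    hfIndex H ≤ N := by
  rw [hfIndex_eq hθ]
  exact sInf_le ⟨N, hN0, rfl, hN⟩

lemma le_hfIndex (hθ : IsWeakTransferHom θ) {c : ℕ∞}
    (h : ∀ N, 0 < N → PowerDetectsUniqueLength G N → c ≤ N) : c ≤ hfIndex H := by
  rw [hfIndex_eq hθ]
  refine le_sInf ?_
  rintro _ ⟨N, hN0, rfl, hN⟩
  exact h N hN0 hN

lemma groupExp_lt_top_iff : groupExp G < ⊤ ↔ AddMonoid.ExponentExists G := by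
  rw [groupExp]
  split_ifs with h
  · simpa using h
  · simpa using h

lemma groupExp_eq (h : AddMonoid.ExponentExists G) : groupExp G = AddMonoid.exponent G := by
  rw [groupExp, if_pos h]

theorem hfIndex_lt_top_iff (hθ : IsWeakTransferHom θ) : hfIndex H < ⊤ ↔ groupExp G < ⊤ := by
  rw [groupExp_lt_top_iff]
  constructor
  · intro h
    rw [hfIndex_eq hθ, sInf_lt_iff] at h
    obtain ⟨_, ⟨N, hN0, -, hN⟩, -⟩ := h
    exact hN.exponentExists hN0
  · rintro ⟨n, hn, hexp⟩
    by_cases h6 : n ≤ 6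
    · exact (hfIndex_le hθ hn (powerDetectsUniqueLength_of_le_six hn h6 hexp)).trans_lt
        (ENat.natCast_lt_top _)
    · exact (hfIndex_le hθ (by omega)
        (powerDetectsUniqueLength_of_seven_le (by omega) hexp)).trans_lt (ENat.natCast_lt_top _)

theorem groupExp_le_hfIndex (hθ : IsWeakTransferHom θ) (hG : ENat.card G ≠ 2)
    (h : groupExp G < ⊤) : groupExp G ≤ hfIndex H := by
  rw [groupExp_eq (groupExp_lt_top_iff.1 h)]
  refine le_hfIndex hθ fun N hN0 hN => ?_
  exact_mod_cast hN.exponent_le hN0 hG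

lemma natCast_le_three_halves_mul (h : 2 * N + 3 ≤ 3 * n) :
    (N : ENNReal) ≤ (3 / 2 : ENNReal) * ((n : ENNReal) - 1) := by
  obtain ⟨m, rfl⟩ := Nat.exists_eq_succ_of_ne_zero (show n ≠ 0 by omega)
  rw [Nat.succ_eq_add_one, Nat.cast_add, Nat.cast_one,
    ENNReal.add_sub_cancel_right ENNReal.one_ne_top, div_eq_mul_inv, mul_right_comm,
    ← div_eq_mul_inv, ENNReal.le_div_iff_mul_le (by simp) (by simp)]
  have : N * 2 ≤ 3 * m := by omega
  exact_mod_cast this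

theorem hfIndex_le_three_halves_mul (hθ : IsWeakTransferHom θ) (h : groupExp G < ⊤)
    (h3 : 3 ≤ groupExp G) :
    ((hfIndex H : ℕ∞) : ENNReal) ≤ (3 / 2 : ENNReal) * (((groupExp G : ℕ∞) : ENNReal) - 1) := by
  have hex := groupExp_lt_top_iff.1 h
  rw [groupExp_eq hex] at h3 ⊢
  have h3' : 3 ≤ AddMonoid.exponent G := by exact_mod_cast h3
  have hexp : ∀ g : G, AddMonoid.exponent G • g = 0 := AddMonoid.exponent_nsmul_eq_zero
  have key : ∀ N : ℕ, 0 < N → PowerDetectsUniqueLength G N →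
      2 * N + 3 ≤ 3 * AddMonoid.exponent G → ((hfIndex H : ℕ∞) : ENNReal) ≤
        (3 / 2 : ENNReal) * (((AddMonoid.exponent G : ℕ∞) : ENNReal) - 1) := by
    intro N hN0 hN hle
    refine (ENat.toENNReal_le.2 (hfIndex_le hθ hN0 hN)).trans ?_
    rw [ENat.toENNReal_coe, ENat.toENNReal_coe]
    exact natCast_le_three_halves_mul hle
  -- For small exponents the bound `n` suffices, since `n ≤ 3 (n - 1) / 2` as soon as `n ≥ 3`.
  by_cases h6 : AddMonoid.exponent G ≤ 6
  · exact key _ (by omega) (powerDetectsUniqueLength_of_le_six (by omega) h6 hexp) (by omega)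
  · exact key _ (by omega) (powerDetectsUniqueLength_of_seven_le (by omega) hexp) (by omega)

theorem hfIndex_eq_groupExp (hθ : IsWeakTransferHom θ) (hG : ENat.card G ≠ 2)
    (h : IsAddCyclic G ∨ groupExp G ≤ 6) : hfIndex H = groupExp G := by
  by_cases ht : groupExp G < ⊤
  · refine le_antisymm ?_ (groupExp_le_hfIndex hθ hG ht)
    have hex := groupExp_lt_top_iff.1 ht
    have hpos : 0 < AddMonoid.exponent G :=
      Nat.pos_of_ne_zero (AddMonoid.exponent_ne_zero.2 hex)
    have hexp : ∀ g : G, AddMonoid.exponent G • g = 0 := AddMonoid.exponent_nsmul_eq_zero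
    rw [groupExp_eq hex] at h ⊢
    refine hfIndex_le hθ hpos ?_
    rcases h with h | h
    · exact powerDetectsUniqueLength_of_isAddCyclic hpos hexp
    · exact powerDetectsUniqueLength_of_le_six hpos (by exact_mod_cast h) hexp
  -- The infinite cyclic group falls here: both sides are infinite.
  · have ht' := mt (hfIndex_lt_top_iff hθ).1 ht
    rw [not_lt_top_iff] at ht ht'
    rw [ht, ht']

end Index

end ZeroSum

theorem theorem1p2 {H G : Type*} [Monoid H] [AddCommGroup G] (hH : IsTransferKrullOver H G) :
    (hfIndex H < ⊤ ↔ groupExp G < ⊤) ∧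
    (groupExp G < ⊤ → 3 ≤ ENat.card G →
      groupExp G ≤ hfIndex H ∧
      (3 ≤ groupExp G →
        ((hfIndex H : ℕ∞) : ENNReal) ≤ (3 / 2 : ENNReal) * (((groupExp G : ℕ∞) : ENNReal) - 1))) ∧
    (ENat.card G ≠ 2 → (IsAddCyclic G ∨ groupExp G ≤ 6) → hfIndex H = groupExp G) := by
  obtain ⟨θ, hθ⟩ := hH
  refine ⟨ZeroSum.hfIndex_lt_top_iff hθ, fun h hG => ⟨?_, ?_⟩, ?_⟩
  · refine ZeroSum.groupExp_le_hfIndex hθ (fun h2 => ?_) h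
    rw [h2] at hG
    exact absurd hG (by decide)
  · exact ZeroSum.hfIndex_le_three_halves_mul hθ h
  · exact ZeroSum.hfIndex_eq_groupExp hθ
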